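/- Let $\pi=(\pi_j)_{j\in\mathbb Z}$ be a random probability distribution on $\mathbb Z$ ($\pi_j\ge 0$, $\sum_j\pi_j=1$ a.s.) which is not almost surely a point mass, i.e. $\mathbb P(\exists j:\ \pi_j=1)<1$. Let $\Pi(n)=(\pi_{i,j}(n))_{i,j\in\mathbb Z}$, $n=1,2,\dots$, be random matrices whose recentred rows $(\pi_{i,i+j}(n))_{j\in\mathbb Z}$, over all $i\in\mathbb Z$ and $n\ge1$, are i.i.d. copies of $\pi$, and write $\Pi(1:n)=\Pi(1)\cdots\Pi(n)$. Masses evolve by $\tau^{n+1}=\tau^n\Pi(n+1)$, where $\tau^0$ is independent of the matrices. Then there is a random sequence $\tau^\infty=(\tau^\infty_i)_{i\in\mathbb Z}$ of (not necessarily independent) non-negative random variables with $\mathbb E\tau^\infty_i=1$ for all $i$, such that: (i) if $\tau^\infty$ is taken independent of $\Pi(1)$, then the sums defining $\tau^\infty\Pi(1)$ converge a.s. and $\tau^\infty\Pi(1)\overset{d}{=}\tau^\infty$; (ii) for every $\tau^0$ independent of the matrices whose coordinates are i.i.d., non-negative, with mean $\mu$ and finite second moment, the sums defining $\tau^0\Pi(1:n)$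 converge a.s. for all $n$, and $\tau^0\Pi(1:n)\Rightarrow\mu\,\tau^\infty$ as $n\to\infty$, in the sense of weak convergence of all finite-dimensional distributions. Moreover, $\tau^\infty$ is unique up to distribution and scaling: if $\tau'$ is a non-negative random sequence that satisfies (i), and if for at least one $\tau^0$ as in (ii) with $\mu>0$ one has $\tau^0\Pi(1:n)\Rightarrow a\tau'$ for some constant $a\in\mathbb R$, then $\tau'\overset{d}{=}c\,\tau^\infty$ for some constant $c>0$. -/

import Mathlib

open MeasureTheory ProbabilityTheory Filter

universe u

namespace MassExchange

/-- A mass configuration on `ℤ` (a row vector). -/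
abbrev Config := ℤ → ℝ

/-- A two-sided infinite matrix. -/
abbrev Mat := ℤ → ℤ → ℝ

/-- Row vector times matrix: `(τ A)_j = ∑_i τ_i A_{ij}`. -/
noncomputable def vecMul (τ : Config) (A : Mat) : Config :=
  fun j => ∑' i : ℤ, τ i * A i j

/-- Product of two-sided infinite matrices: `(A B)_{ij} = ∑_k A_{ik} B_{kj}`. -/
noncomputable def matMul (A B : Mat) : Mat :=
  fun i j => ∑' k : ℤ, A i k * B k j

/-- The identity matrix. -/
def matOne : Mat := fun i j => if i = j then 1 else 0

/-- `matProd M n = M 0 * M 1 * ⋯ * M (n - 1)`. The exchange matrices `Π(1), Π(2), …` are indexed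
from zero (`M k` is `Π(k + 1)`), so this is `Π(1:n) = Π(1) ⋯ Π(n)`. -/
noncomputable def matProd (M : ℕ → Mat) : ℕ → Mat
  | 0 => matOne
  | n + 1 => matMul (matProd M n) (M n)

/-- `ρ` is the law of a random probability distribution `(π_j)_{j ∈ ℤ}` on `ℤ`. -/
def IsSharingLaw (ρ : ProbabilityMeasure (ℤ → ℝ)) : Prop :=
  ∀ᵐ p ∂(ρ : Measure (ℤ → ℝ)), (∀ j, 0 ≤ p j) ∧ HasSum p 1

/-- The sharing distribution is almost surely a point mass (each agent always hands its whole mass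
to a single agent). -/
def IsAlmostSurelyDirac (ρ : ProbabilityMeasure (ℤ → ℝ)) : Prop :=
  ∀ᵐ p ∂(ρ : Measure (ℤ → ℝ)), ∃ j, p j = 1

variable {Ω Ω' : Type*} [MeasurableSpace Ω] [MeasurableSpace Ω']

/-- Translation invariance: the recentred rows `(π_{i,i+j}(n))_{j ∈ ℤ}`, over all agents `i` and
all times `n`, are i.i.d. with law `ρ`. -/
structure IsExchange (ρ : ProbabilityMeasure (ℤ → ℝ)) (P : Measure Ω)
    (M : ℕ → Ω → Mat) : Prop where
  measurable_row : ∀ (n : ℕ) (i : ℤ), Measurable fun ω (j : ℤ) => M n ω i (i + j)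
  law_row : ∀ (n : ℕ) (i : ℤ), P.map (fun ω (j : ℤ) => M n ω i (i + j)) = ρ
  indep_rows : iIndepFun (fun (q : ℕ × ℤ) ω (j : ℤ) => M q.1 ω q.2 (q.2 + j)) P

/-- The coordinates of `τ` are i.i.d. non-negative random variables with mean `m` and finite
second moment. -/
structure IsInitial (P : Measure Ω) (τ : Ω → Config) (m : ℝ) : Prop where
  measurable_coord : ∀ i : ℤ, Measurable fun ω => τ ω i
  indep : iIndepFun (fun (i : ℤ) ω => τ ω i) P
  ident : ∀ i j : ℤ, IdentDistrib (fun ω => τ ω i) (fun ω => τ ω j) P P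
  nonneg : ∀ i : ℤ, ∀ᵐ ω ∂P, 0 ≤ τ ω i
  memLp_two : ∀ i : ℤ, MemLp (fun ω => τ ω i) 2 P
  mean_eq : ∀ i : ℤ, ∫ ω, τ ω i ∂P = m

/-- Weak convergence of all finite-dimensional sub-vectors of the random sequences `X n` to those
of the random sequence `Z` (which may live on another probability space). -/
def WeakConv (P : Measure Ω) [IsProbabilityMeasure P] (P' : Measure Ω') [IsProbabilityMeasure P']
    (X : ℕ → Ω → Config) (Z : Ω' → Config) : Prop :=
  ∀ J : Finset ℤ, TendstoInDistribution (fun n ω (j : J) => X n ω j) atTop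
    (fun ω (j : J) => Z ω j) (fun _ => P) P'

/-- `ν` is the law of a fixed point: a random non-negative configuration `τ` with law `ν`,
independent of the exchange matrix `Π(1)`, can almost surely be exchanged (all sums converge), and
`τ Π(1)` has law `ν` again. -/
def IsFixedPoint (ρ : ProbabilityMeasure (ℤ → ℝ)) (ν : ProbabilityMeasure Config) : Prop :=
  (∀ᵐ x ∂(ν : Measure Config), ∀ i, 0 ≤ x i) ∧
  ∀ (Ω : Type u) [MeasurableSpace Ω] (P : Measure Ω) [IsProbabilityMeasure P]
    (τ : Ω → Config) (M : ℕ → Ω → Mat),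
    IsExchange ρ P M → Measurable τ → P.map τ = ν → IndepFun τ (M 0) P →
      (∀ᵐ ω ∂P, ∀ j, Summable fun i => τ ω i * M 0 ω i j) ∧
      AEMeasurable (fun ω => vecMul (τ ω) (M 0 ω)) P ∧
      P.map (fun ω => vecMul (τ ω) (M 0 ω)) = ν

end MassExchange

/-!
The stationary configuration is the limit of a martingale. Let `X^n_j` be the total mass that agent
`j` receives if all agents start with mass one and the exchange matrices are applied in the order
`Π(n), …, Π(1)`, that is, `X^n_j` is the `j`-th column sum of `Π(n) ⋯ Π(1)`. Since the mean matrix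
has column sums one, `X^n_j` is a martingale in `n`, and for each fixed `n` the reversal of time
does not change its law. If the martingale is bounded in `L²`, it has a limit `Ξ_j` with mean one,
and passing to the limit in `X^{n+1}(Π(1), Π(2), …) = X^n(Π(2), Π(3), …) Π(1)` shows that the law of
`Ξ` is a fixed point (`IsLimitMass.push_eq`).

The `L²` bound comes from a renewal equation. Let `p` be the mean row, `p^m` its convolution powers
and `s_m = ∑_d p^m(d)²`. Replacing the random exchanges one at a time by mean ones, and using that
the rows of one matrix are independent, gives `E (X^n)² = 1 + ∑_{k<n} E (X^k)² b_{n-1-k}`, where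
`b_m = v_m - s_{m+1} ≥ 0` is the total variance of a row averaged along `p^m`, and `v_m` its second
moment (`secondMoment_renewal`). By Jensen's inequality `v_m ≤ s_m`, so that the series telescopes:
`∑ b_m ≤ v_0 = E ∑_d π_d²`, and this is less than one exactly if the row is not almost surely a
point mass. The equation is thus defective and its solution is bounded (`renewal_bounded`).

The same equation with `s_n` in place of the constant one governs `w_n = ∑_i E (Π(n) ⋯ Π(1))_{ij}²`.
Here `s_n → 0`, because a non-degenerate random walk spreads out (`tendsto_collision`), and hence
`w_n → 0` (`tendsto_sum_sq_backProd`). For an i.i.d. initial configuration with mean `m` the squared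
`L²` distance of the mass at `j` from `m X^n_j` is at most a multiple of `w_n`, so that the
configuration after `n` exchanges converges in law to `m Ξ`. Uniqueness then follows from the
uniqueness of limits in distribution, the mean one fixing the sign of the scalar.

All moments are computed with values in `[0, ∞]`, where sums and products need no summability
conditions; identities that would involve negative terms are stated with these terms moved to the
other side.
-/

namespace MassExchange

open scoped ENNReal Topology

section

/-! ### Squared distances and variances with values in `[0, ∞]` -/

/-- The squared distance of two points of `[0, ∞]`. One of the two truncated differences vanishes,
so that the polarisation identity `sq_add_sq_eq` holds without any finiteness assumption. -/
noncomputable def sqDist (a b : ℝ≥0∞) : ℝ≥0∞ := (a - b) ^ 2 + (b - a) ^ 2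

lemma sqDist_comm (a b : ℝ≥0∞) : sqDist a b = sqDist b a := add_comm _ _

@[fun_prop]
lemma measurable_sqDist {Ω : Type*} [MeasurableSpace Ω] {f g : Ω → ℝ≥0∞} (hf : Measurable f)
    (hg : Measurable g) : Measurable fun ω => sqDist (f ω) (g ω) := by
  unfold sqDist; fun_prop

lemma sq_add_sq_eq (a b : ℝ≥0∞) : a ^ 2 + b ^ 2 = 2 * (a * b) + sqDist a b := by
  wlog h : a ≤ b generalizing a b
  · rw [add_comm, this b a (le_of_not_ge h), sqDist_comm, mul_comm b a]
  obtain ⟨d, rfl⟩ := exists_add_of_le h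
  by_cases ha : a = ∞
  · subst ha; simp [sqDist]
  · rw [sqDist, tsub_eq_zero_of_le h, ENNReal.add_sub_cancel_left ha]
    ring

lemma two_mul_le_sq_add_sq (a b : ℝ≥0∞) : 2 * (a * b) ≤ a ^ 2 + b ^ 2 := by
  rw [sq_add_sq_eq]; exact le_self_add

lemma add_sq_le_two (a b : ℝ≥0∞) : (a + b) ^ 2 ≤ 2 * a ^ 2 + 2 * b ^ 2 := by
  calc (a + b) ^ 2 = a ^ 2 + b ^ 2 + 2 * (a * b) := by ring
    _ ≤ a ^ 2 + b ^ 2 + (a ^ 2 + b ^ 2) := by gcongr; exact two_mul_le_sq_add_sq a b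
    _ = _ := by ring

lemma sqDist_triangle (a b c : ℝ≥0∞) : sqDist a c ≤ 2 * sqDist a b + 2 * sqDist b c := by
  unfold sqDist
  calc (a - c) ^ 2 + (c - a) ^ 2
      ≤ ((a - b) + (b - c)) ^ 2 + ((c - b) + (b - a)) ^ 2 := by
        gcongr <;> exact tsub_le_tsub_add_tsub
    _ ≤ (2 * (a - b) ^ 2 + 2 * (b - c) ^ 2) + (2 * (c - b) ^ 2 + 2 * (b - a) ^ 2) := by
        gcongr <;> exact add_sq_le_two _ _
    _ = _ := by ring

lemma lintegral_sqDist_triangle {Ω : Type*} [MeasurableSpace Ω] {P : Measure Ω}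
    {f g h : Ω → ℝ≥0∞} (hf : Measurable f) (hg : Measurable g) (hh : Measurable h) :
    ∫⁻ ω, sqDist (f ω) (h ω) ∂P ≤
      2 * ∫⁻ ω, sqDist (f ω) (g ω) ∂P + 2 * ∫⁻ ω, sqDist (g ω) (h ω) ∂P := by
  rw [← lintegral_const_mul _ (by fun_prop), ← lintegral_const_mul _ (by fun_prop),
    ← lintegral_add_left (by fun_prop)]
  exact lintegral_mono fun ω => sqDist_triangle _ _ _

lemma sqDist_mul (c a b : ℝ≥0∞) (hc : c ≠ ∞) : sqDist (c * a) (c * b) = c ^ 2 * sqDist a b := by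
  unfold sqDist
  rw [← ENNReal.mul_sub (fun _ _ => hc), ← ENNReal.mul_sub (fun _ _ => hc)]
  ring

lemma sqDist_ofReal {x y : ℝ} (hx : 0 ≤ x) (hy : 0 ≤ y) :
    sqDist (ENNReal.ofReal x) (ENNReal.ofReal y) = ENNReal.ofReal ((x - y) ^ 2) := by
  wlog h : x ≤ y generalizing x y
  · rw [sqDist_comm, this hy hx (le_of_not_ge h)]; congr 1; ring
  rw [sqDist, tsub_eq_zero_of_le (ENNReal.ofReal_le_ofReal h), ← ENNReal.ofReal_sub _ hx,
    ← ENNReal.ofReal_pow (by linarith), zero_pow two_ne_zero, zero_add]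
  congr 1; ring

/-- Jensen's inequality for a discrete probability distribution `w`, with a quantitative gain: the
variance of `g` is at least half of the contribution of any given pair `(x, y)`. -/
lemma two_mul_sq_tsum_add_le {ι : Type*} {w : ι → ℝ≥0∞} (hw : ∑' i, w i = 1) (g : ι → ℝ≥0∞)
    (x y : ι) :
    2 * (∑' i, w i * g i) ^ 2 + w x * w y * sqDist (g x) (g y) ≤ 2 * ∑' i, w i * g i ^ 2 := by
  have e1 : 2 * ∑' i, w i * g i ^ 2 = ∑' i, ∑' j, w i * w j * (g i ^ 2 + g j ^ 2) := by
    have h1 : ∑' i, ∑' j, w i * w j * g i ^ 2 = ∑' i, w i * g i ^ 2 := by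
      refine tsum_congr fun i => ?_
      rw [ENNReal.tsum_mul_right, ENNReal.tsum_mul_left, hw, mul_one]
    have h2 : ∑' i, ∑' j, w i * w j * g j ^ 2 = ∑' i, w i * g i ^ 2 := by
      rw [ENNReal.tsum_comm]
      refine Eq.trans (tsum_congr fun i => tsum_congr fun j => ?_) h1
      ring
    simp_rw [mul_add, ENNReal.tsum_add]
    rw [h1, h2, two_mul]
  have e2 : (∑' i, w i * g i) ^ 2 = ∑' i, ∑' j, w i * w j * (g i * g j) := by
    rw [sq, ← ENNReal.tsum_mul_right]
    refine tsum_congr fun i => ?_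
    rw [← ENNReal.tsum_mul_left]
    refine tsum_congr fun j => ?_
    ring
  rw [e1, e2, ← ENNReal.tsum_mul_left]
  simp_rw [sq_add_sq_eq, mul_add, ENNReal.tsum_add, ← ENNReal.tsum_mul_left]
  gcongr ?_ + ?_
  · refine le_of_eq (tsum_congr fun i => tsum_congr fun j => ?_)
    ring
  · exact (ENNReal.le_tsum y).trans (ENNReal.le_tsum (f := fun i => ∑' j, w i * w j *
      sqDist (g i) (g j)) x)

lemma sq_tsum_le {ι : Type*} {w : ι → ℝ≥0∞} (hw : ∑' i, w i = 1) (g : ι → ℝ≥0∞) :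
    (∑' i, w i * g i) ^ 2 ≤ ∑' i, w i * g i ^ 2 := by
  rcases isEmpty_or_nonempty ι with h | ⟨⟨x⟩⟩
  · simp at hw
  have := le_self_add.trans (two_mul_sq_tsum_add_le hw g x x)
  rwa [ENNReal.mul_le_mul_iff_right (by simp) (by simp)] at this

lemma sq_lintegral_le {Ω : Type*} [MeasurableSpace Ω] (P : Measure Ω) [IsProbabilityMeasure P]
    {f : Ω → ℝ≥0∞} (hf : Measurable f) : (∫⁻ ω, f ω ∂P) ^ 2 ≤ ∫⁻ ω, f ω ^ 2 ∂P := by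
  have h := ENNReal.lintegral_mul_le_Lp_mul_Lq P Real.HolderConjugate.two_two hf.aemeasurable
    (aemeasurable_const (b := (1 : ℝ≥0∞)))
  simp only [Pi.mul_apply, mul_one, ENNReal.rpow_ofNat, one_pow, lintegral_const, measure_univ,
    ENNReal.one_rpow] at h
  calc (∫⁻ ω, f ω ∂P) ^ 2 ≤ ((∫⁻ ω, f ω ^ 2 ∂P) ^ (1 / 2 : ℝ)) ^ 2 := by gcongr
    _ = _ := by rw [← ENNReal.rpow_natCast, ← ENNReal.rpow_mul]; simp

lemma lintegral_mul_of_indepFun {Ω : Type*} [MeasurableSpace Ω] {P : Measure Ω} {f g : Ω → ℝ≥0∞}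
    (hf : Measurable f) (hg : Measurable g) (h : IndepFun f g P) :
    ∫⁻ ω, f ω * g ω ∂P = (∫⁻ ω, f ω ∂P) * ∫⁻ ω, g ω ∂P :=
  lintegral_mul_eq_lintegral_mul_lintegral_of_indepFun hf hg h

/-- The variance of a linear combination of pairwise independent variables is the sum of the
variances, written without subtraction. -/
lemma lintegral_sq_tsum_of_indep {Ω ι : Type*} [Countable ι] [MeasurableSpace Ω] {P : Measure Ω}
    {Z : ι → Ω → ℝ≥0∞} (hZ : ∀ i, Measurable (Z i))
    (hi : Pairwise fun i j => IndepFun (Z i) (Z j) P) (x : ι → ℝ≥0∞) :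
    ∫⁻ ω, (∑' i, x i * Z i ω) ^ 2 ∂P + ∑' i, x i ^ 2 * (∫⁻ ω, Z i ω ∂P) ^ 2 =
      (∑' i, x i * ∫⁻ ω, Z i ω ∂P) ^ 2 + ∑' i, x i ^ 2 * ∫⁻ ω, Z i ω ^ 2 ∂P := by
  have sq_eq (f : ι → ℝ≥0∞) : (∑' i, f i) ^ 2 = ∑' i, ∑' j, f i * f j := by
    rw [sq, ← ENNReal.tsum_mul_right]
    exact tsum_congr fun i => ENNReal.tsum_mul_left.symm
  have e1 : ∫⁻ ω, (∑' i, x i * Z i ω) ^ 2 ∂P =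
      ∑' i, ∑' j, x i * x j * ∫⁻ ω, Z i ω * Z j ω ∂P := by
    simp_rw [sq_eq]
    rw [lintegral_tsum fun i => by fun_prop]
    refine tsum_congr fun i => ?_
    rw [lintegral_tsum fun j => by fun_prop]
    refine tsum_congr fun j => ?_
    rw [← lintegral_const_mul _ (by fun_prop)]
    exact lintegral_congr fun ω => by ring
  rw [e1, sq_eq, ← ENNReal.tsum_add, ← ENNReal.tsum_add]
  refine tsum_congr fun i => ?_
  -- the two rows of the double sum agree off the diagonal, and the correction swaps the
  -- diagonal terms
  classical
  rw [ENNReal.tsum_eq_add_tsum_ite i, ENNReal.tsum_eq_add_tsum_ite (f := fun j =>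
    x i * (∫⁻ ω, Z i ω ∂P) * (x j * ∫⁻ ω, Z j ω ∂P)) i]
  have : ∑' j, (if j = i then 0 else x i * x j * ∫⁻ ω, Z i ω * Z j ω ∂P) =
      ∑' j, (if j = i then 0 else x i * (∫⁻ ω, Z i ω ∂P) * (x j * ∫⁻ ω, Z j ω ∂P)) := by
    refine tsum_congr fun j => ?_
    split_ifs with h
    · rfl
    · rw [lintegral_mul_of_indepFun (hZ i) (hZ j) (hi (Ne.symm h))]; ring
  rw [this]
  simp_rw [← sq]
  ring

/-! ### A defective renewal equation -/

lemma renewal_expand {H : ℕ → ℕ → ℝ≥0∞} {b : ℕ → ℝ≥0∞}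
    (hH : ∀ m k, H m (k + 1) = H (m + 1) k + H 0 k * b m) (m k : ℕ) :
    H m k = H (m + k) 0 + ∑ i ∈ Finset.range k, H 0 i * b (m + k - 1 - i) := by
  induction k generalizing m with
  | zero => simp
  | succ k ih =>
    rw [hH, ih, Finset.sum_range_succ, ← add_assoc]
    have e : m + 1 + k = m + (k + 1) := by ring
    rw [e]
    congr 3
    omega

lemma renewal_bounded {c b : ℕ → ℝ≥0∞} {h v : ℝ≥0∞} (hv : v < 1) (hb : ∑' m, b m ≤ v)
    (hc : ∀ n, c n ≤ h + ∑ i ∈ Finset.range n, c i * b (n - 1 - i)) (n : ℕ) :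
    c n ≤ h * (1 - v)⁻¹ := by
  induction n using Nat.strong_induction_on with
  | _ n ih =>
    have hv' : (1 - v) ≠ 0 := (tsub_pos_of_lt hv).ne'
    calc c n ≤ h + ∑ i ∈ Finset.range n, c i * b (n - 1 - i) := hc n
      _ ≤ h + ∑ i ∈ Finset.range n, h * (1 - v)⁻¹ * b (n - 1 - i) := by
        gcongr with i hi
        exact ih i (Finset.mem_range.1 hi)
      _ = h + h * (1 - v)⁻¹ * ∑ i ∈ Finset.range n, b i := by
        rw [← Finset.mul_sum, Finset.sum_range_reflect]
      _ ≤ h + h * (1 - v)⁻¹ * v := by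
        gcongr
        exact (ENNReal.sum_le_tsum _).trans hb
      _ = h * ((1 - v)⁻¹ * (1 - v)) + h * (1 - v)⁻¹ * v := by
        rw [ENNReal.inv_mul_cancel hv' (by finiteness), mul_one]
      _ = h * (1 - v)⁻¹ * (1 - v + v) := by ring
      _ = h * (1 - v)⁻¹ := by rw [tsub_add_cancel_of_le hv.le, mul_one]

/-- If the inhomogeneity of a defective renewal equation tends to zero, so does its solution. -/
lemma renewal_tendsto_zero {c b h : ℕ → ℝ≥0∞} {v : ℝ≥0∞} (hv : v < 1) (hb : ∑' m, b m ≤ v)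
    (hh : Tendsto h atTop (𝓝 0)) (hh1 : ∀ n, h n ≤ 1)
    (hc : ∀ n, c n = h n + ∑ i ∈ Finset.range n, c i * b (n - 1 - i)) :
    Tendsto c atTop (𝓝 0) := by
  have hbd := renewal_bounded (h := 1) hv hb fun n => (hc n).le.trans (by gcongr; exact hh1 n)
  rw [one_mul] at hbd
  have hfin : (1 - v)⁻¹ ≠ ∞ := by
    rw [ENNReal.inv_ne_top]; exact (tsub_pos_of_lt hv).ne'
  set L := limsup c atTop with hL
  have hLfin : L ≠ ∞ := ne_top_of_le_ne_top hfin
    (limsup_le_of_le (by isBoundedDefault) (Eventually.of_forall hbd))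
  obtain ⟨f, f_def⟩ : ∃ f : ℕ → ℕ → ℝ≥0∞,
      ∀ n m, f n m = if m < n then b m * c (n - 1 - m) else 0 := ⟨_, fun _ _ => rfl⟩
  have hf (n) : ∑ i ∈ Finset.range n, c i * b (n - 1 - i) = ∑' m, f n m := by
    rw [tsum_eq_sum (s := Finset.range n), ← Finset.sum_range_reflect]
    · refine Finset.sum_congr rfl fun i hi => ?_
      have hi' := Finset.mem_range.1 hi
      rw [f_def, if_pos hi', mul_comm]
      congr 2; omega
    · intro m hm
      rw [f_def, if_neg (by simpa using hm)]
  have hlim (m) : limsup (fun n => f n m) atTop ≤ b m * L := by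
    have : limsup (fun n => f (n + (m + 1)) m) atTop = limsup (fun n => f n m) atTop :=
      limsup_nat_add (fun n => f n m) (m + 1)
    rw [← this, ← ENNReal.limsup_const_mul_of_ne_top]
    · refine le_of_eq ?_
      congr 1; funext n
      have e : n + (m + 1) - 1 - m = n := by omega
      rw [f_def, if_pos (by omega), e]
    · exact ne_top_of_le_ne_top hv.ne_top ((ENNReal.le_tsum m).trans (hb.trans le_rfl))
  have key : L ≤ v * L := by
    have h1 : limsup (fun n => ∑' m, f n m) atTop ≤ ∑' m, limsup (fun n => f n m) atTop := by
      simp_rw [← lintegral_count]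
      refine limsup_lintegral_le (fun m => b m * (1 - v)⁻¹) (fun n => measurable_of_countable _)
        (fun n => ?_) ?_
      · refine Eventually.of_forall fun m => ?_
        rw [f_def]
        split_ifs
        · exact mul_le_mul_right (hbd _) _
        · exact zero_le
      · rw [lintegral_count, ENNReal.tsum_mul_right]
        exact ENNReal.mul_ne_top (ne_top_of_le_ne_top hv.ne_top hb) hfin
    calc L = limsup (h + fun n => ∑' m, f n m) atTop := by
            rw [hL]; congr 1; funext n; rw [hc n, hf]; rfl
      _ = limsup (fun n => ∑' m, f n m) atTop := ENNReal.limsup_add_of_left_tendsto_zero hh _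
      _ ≤ ∑' m, b m * L := h1.trans (ENNReal.tsum_le_tsum hlim)
      _ ≤ v * L := by rw [ENNReal.tsum_mul_right]; gcongr
  have hL0 : L = 0 := by
    by_contra h0
    have : v * L < 1 * L := by
      rw [mul_comm, mul_comm 1]
      exact ENNReal.mul_lt_mul_right h0 hLfin hv
    rw [one_mul] at this
    exact absurd key (not_le.2 this)
  exact tendsto_of_le_liminf_of_limsup_le zero_le (hL0 ▸ le_rfl)

end

section

/-! ### Collision probabilities of a random walk -/

/-- `walk p m` is the `m`-step distribution of the random walk on `ℤ` with step distribution `p`. -/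
noncomputable def walk (p : ℤ → ℝ≥0∞) : ℕ → ℤ → ℝ≥0∞
  | 0 => fun d => if d = 0 then 1 else 0
  | m + 1 => fun d => ∑' e, p e * walk p m (d - e)

/-- The probability that two independent random walks with common start meet at time `m`. -/
noncomputable def collision (p : ℤ → ℝ≥0∞) (m : ℕ) : ℝ≥0∞ := ∑' d, walk p m d ^ 2

lemma tsum_sub_right (f : ℤ → ℝ≥0∞) (e : ℤ) : ∑' d, f (d - e) = ∑' d, f d :=
  (Equiv.subRight e).tsum_eq f

lemma tsum_sub_left (f : ℤ → ℝ≥0∞) (e : ℤ) : ∑' d, f (e - d) = ∑' d, f d :=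
  (Equiv.subLeft e).tsum_eq f

lemma tsum_add_right (f : ℤ → ℝ≥0∞) (e : ℤ) : ∑' d, f (d + e) = ∑' d, f d :=
  (Equiv.addRight e).tsum_eq f

variable {p : ℤ → ℝ≥0∞}

lemma tsum_walk (hp : ∑' d, p d = 1) (m : ℕ) : ∑' d, walk p m d = 1 := by
  induction m with
  | zero => simp [walk, tsum_ite_eq]
  | succ m ih =>
    simp_rw [walk]
    rw [ENNReal.tsum_comm]
    simp_rw [ENNReal.tsum_mul_left, tsum_sub_right, ih, mul_one, hp]

lemma walk_le_one (hp : ∑' d, p d = 1) (m : ℕ) (d : ℤ) : walk p m d ≤ 1 :=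
  (ENNReal.le_tsum d).trans (tsum_walk hp m).le

lemma collision_le_one (hp : ∑' d, p d = 1) (m : ℕ) : collision p m ≤ 1 := by
  rw [← tsum_walk hp m]
  refine ENNReal.tsum_le_tsum fun d => ?_
  rw [sq]
  exact mul_le_of_le_one_left zero_le (walk_le_one hp m d)

/-- One step of the walk decreases the collision probability by at least a multiple of the squared
`ℓ²` distance between the law of the walk and a translate of it. -/
lemma collision_succ_add_le (hp : ∑' d, p d = 1) (m : ℕ) (x y : ℤ) :
    2 * collision p (m + 1) +
      p x * p y * ∑' z, sqDist (walk p m z) (walk p m (z + (x - y))) ≤ 2 * collision p m := by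
  have e1 : ∑' z, sqDist (walk p m z) (walk p m (z + (x - y))) =
      ∑' z, sqDist (walk p m (z - x)) (walk p m (z - y)) := by
    rw [← tsum_sub_right _ x]
    refine tsum_congr fun z => ?_
    congr 2; ring
  have e2 : collision p m = ∑' z, ∑' e, p e * walk p m (z - e) ^ 2 := by
    rw [ENNReal.tsum_comm]
    simp_rw [ENNReal.tsum_mul_left]
    have (e : ℤ) : ∑' z, walk p m (z - e) ^ 2 = collision p m :=
      tsum_sub_right (fun z => walk p m z ^ 2) e
    simp_rw [this]
    rw [ENNReal.tsum_mul_right, hp, one_mul]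
  rw [e1, e2, collision]
  simp_rw [← ENNReal.tsum_mul_left]
  rw [← ENNReal.tsum_add]
  refine ENNReal.tsum_le_tsum fun z => ?_
  rw [ENNReal.tsum_mul_left]
  exact two_mul_sq_tsum_add_le hp (fun e => walk p m (z - e)) x y

lemma collision_succ_le (hp : ∑' d, p d = 1) (m : ℕ) : collision p (m + 1) ≤ collision p m := by
  have := le_self_add.trans (collision_succ_add_le hp m 0 0)
  rwa [ENNReal.mul_le_mul_iff_right (by simp) (by simp)] at this

/-- Two independent copies of a non-degenerate random walk are ever less likely to meet. The
decrements of the collision probability tend to zero, so the law of the walk becomes invariant under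
the translations by all multiples of `x - y`; its `ℓ²` norm must then vanish in the limit, as its
translates share a total mass of one. -/
lemma tendsto_collision (hp : ∑' d, p d = 1) {x y : ℤ} (hxy : x ≠ y) (hx : p x ≠ 0)
    (hy : p y ≠ 0) : Tendsto (collision p) atTop (𝓝 0) := by
  have hp_fin (d : ℤ) : p d ≠ ∞ :=
    ne_top_of_le_ne_top ENNReal.one_ne_top ((ENNReal.le_tsum d).trans hp.le)
  set L := ⨅ n, collision p n
  have hL : Tendsto (collision p) atTop (𝓝 L) :=
    tendsto_atTop_iInf (antitone_nat_of_succ_le (collision_succ_le hp))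
  have hL_fin : L ≠ ∞ :=
    ne_top_of_le_ne_top ENNReal.one_ne_top ((iInf_le _ 0).trans (collision_le_one hp 0))
  let D : ℤ → ℕ → ℝ≥0∞ := fun e n => ∑' z, sqDist (walk p n z) (walk p n (z + e))
  have hD1 : Tendsto (D (x - y)) atTop (𝓝 0) := by
    have h1 (n) : D (x - y) n ≤
        (p x * p y)⁻¹ * (2 * collision p n - 2 * collision p (n + 1)) := by
      rw [← ENNReal.div_eq_inv_mul, ENNReal.le_div_iff_mul_le
        (Or.inl (mul_ne_zero hx hy)) (Or.inl (ENNReal.mul_ne_top (hp_fin _) (hp_fin _)))]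
      refine ENNReal.le_sub_of_add_le_left ?_ ?_
      · exact ENNReal.mul_ne_top (by simp)
          (ne_top_of_le_ne_top ENNReal.one_ne_top (collision_le_one hp _))
      · rw [mul_comm (D _ _)]
        exact collision_succ_add_le hp n x y
    have h2 : Tendsto (fun n => (p x * p y)⁻¹ *
        (2 * collision p n - 2 * collision p (n + 1))) atTop (𝓝 0) := by
      have h3 := ENNReal.Tendsto.const_mul (a := 2) hL (Or.inr (by simp))
      have h4 := ENNReal.Tendsto.sub h3 (h3.comp (tendsto_add_atTop_nat 1))
        (Or.inl (ENNReal.mul_ne_top (by simp) hL_fin))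
      have h5 := ENNReal.Tendsto.const_mul (a := (p x * p y)⁻¹) h4
        (Or.inr (ENNReal.inv_ne_top.2 (mul_ne_zero hx hy)))
      simpa using h5
    exact tendsto_of_tendsto_of_tendsto_of_le_of_le tendsto_const_nhds h2
      (fun _ => zero_le) h1
  have hDk (k : ℕ) : Tendsto (D (k * (x - y))) atTop (𝓝 0) := by
    induction k with
    | zero =>
      have : D ((0 : ℕ) * (x - y)) = fun _ => 0 := by funext n; simp [D, sqDist]
      rw [this]; exact tendsto_const_nhds
    | succ k ih =>
      have h1 (n) : D ((k + 1 : ℕ) * (x - y)) n ≤ 2 * D (k * (x - y)) n + 2 * D (x - y) n := by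
        have : D (x - y) n = ∑' z, sqDist (walk p n (z + k * (x - y)))
            (walk p n (z + (k + 1 : ℕ) * (x - y))) := by
          refine ((tsum_add_right _ (k * (x - y))).symm.trans ?_)
          refine tsum_congr fun z => ?_
          congr 2; push_cast; ring
        rw [this]
        simp_rw [D, ← ENNReal.tsum_mul_left]
        rw [← ENNReal.tsum_add]
        exact ENNReal.tsum_le_tsum fun z => sqDist_triangle _ _ _
      have h2 : Tendsto (fun n => 2 * D (k * (x - y)) n + 2 * D (x - y) n) atTop (𝓝 0) := by
        simpa using (ENNReal.Tendsto.const_mul (a := 2) ih (Or.inr (by simp))).add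
          (ENNReal.Tendsto.const_mul (a := 2) hD1 (Or.inr (by simp)))
      exact tendsto_of_tendsto_of_tendsto_of_le_of_le tendsto_const_nhds h2
        (fun _ => zero_le) h1
  have hK (K : ℕ) : K * (2 * L) ≤ 2 := by
    have h1 (n) : K * (2 * collision p n) ≤ 2 + ∑ k ∈ Finset.range K, D (k * (x - y)) n := by
      have h2 (e : ℤ) : 2 * collision p n =
          2 * ∑' z, walk p n z * walk p n (z + e) + D e n := by
        have : ∑' z, walk p n (z + e) ^ 2 = collision p n :=
          tsum_add_right (fun z => walk p n z ^ 2) e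
        rw [two_mul]
        nth_rw 2 [← this]
        rw [collision, ← ENNReal.tsum_add, ← ENNReal.tsum_mul_left, ← ENNReal.tsum_add]
        exact tsum_congr fun z => sq_add_sq_eq _ _
      calc K * (2 * collision p n)
          = ∑ k ∈ Finset.range K, 2 * collision p n := by simp
        _ = ∑ k ∈ Finset.range K, (2 * ∑' z, walk p n z * walk p n (z + k * (x - y)) +
              D (k * (x - y)) n) := Finset.sum_congr rfl fun k _ => h2 _
        _ = 2 * ∑' z, walk p n z * ∑ k ∈ Finset.range K, walk p n (z + k * (x - y)) +
              ∑ k ∈ Finset.range K, D (k * (x - y)) n := by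
            rw [Finset.sum_add_distrib, ← Finset.mul_sum,
              ← Summable.tsum_finsetSum fun _ _ => ENNReal.summable]
            simp_rw [Finset.mul_sum]
        _ ≤ 2 * ∑' z, walk p n z * 1 + ∑ k ∈ Finset.range K, D (k * (x - y)) n := by
            gcongr with z
            have inj : Function.Injective fun k : ℕ => z + k * (x - y) := by
              intro a b hab
              simpa [sub_ne_zero.2 hxy] using hab
            calc ∑ k ∈ Finset.range K, walk p n (z + k * (x - y))
                ≤ ∑' k : ℕ, walk p n (z + k * (x - y)) := ENNReal.sum_le_tsum _
              _ ≤ ∑' d, walk p n d := ENNReal.tsum_comp_le_tsum_of_injective inj _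
              _ = 1 := tsum_walk hp n
        _ = _ := by simp [tsum_walk hp n]
    have h2 : Tendsto (fun n => 2 + ∑ k ∈ Finset.range K, D (k * (x - y)) n) atTop (𝓝 2) := by
      simpa using tendsto_const_nhds.add
        (tendsto_finsetSum (Finset.range K) fun k _ => hDk k)
    exact le_of_tendsto_of_tendsto' (ENNReal.Tendsto.const_mul
      (ENNReal.Tendsto.const_mul hL (Or.inr (by simp))) (Or.inr (by simp))) h2 h1
  have hL0 : L = 0 := by
    by_contra h0
    obtain ⟨K, hK2⟩ := ENNReal.exists_nat_mul_gt (a := 2 * L) (b := 2) (by simp [h0]) (by simp)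
    exact absurd (hK K) (not_le.2 hK2)
  exact hL0 ▸ hL

/-! ### Averaging a random row along the mean walk -/

/-- The mean of a random row with law `η`. -/
noncomputable def meanRow (η : Measure (ℤ → ℝ≥0∞)) (d : ℤ) : ℝ≥0∞ := ∫⁻ a, a d ∂η

/-- The row `a` after `m` further exchanges with the mean matrix. -/
noncomputable def smoothRow (p : ℤ → ℝ≥0∞) (m : ℕ) (a : ℤ → ℝ≥0∞) (d : ℤ) : ℝ≥0∞ :=
  ∑' e, a e * walk p m (d - e)

/-- The expected squared `ℓ²` norm of a random row after `m` further exchanges with the mean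
matrix. -/
noncomputable def rowMoment (η : Measure (ℤ → ℝ≥0∞)) (m : ℕ) : ℝ≥0∞ :=
  ∑' d, ∫⁻ a, smoothRow (meanRow η) m a d ^ 2 ∂η

@[fun_prop]
lemma measurable_smoothRow (p : ℤ → ℝ≥0∞) (m : ℕ) (d : ℤ) :
    Measurable fun a => smoothRow p m a d := by
  unfold smoothRow; fun_prop

variable {η : Measure (ℤ → ℝ≥0∞)}

lemma lintegral_smoothRow (m : ℕ) (d : ℤ) :
    ∫⁻ a, smoothRow (meanRow η) m a d ∂η = walk (meanRow η) (m + 1) d := by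
  simp_rw [smoothRow]
  rw [lintegral_tsum fun e => Measurable.aemeasurable (by fun_prop)]
  refine tsum_congr fun e => ?_
  rw [lintegral_mul_const _ (by fun_prop)]
  rfl

lemma rowMoment_zero : rowMoment η 0 = ∫⁻ a, ∑' d, a d ^ 2 ∂η := by
  rw [rowMoment, ← lintegral_tsum fun d => by fun_prop]
  refine lintegral_congr fun a => tsum_congr fun d => ?_
  congr 1
  rw [smoothRow, tsum_eq_single d]
  · simp [walk]
  · intro e he
    simp [walk, sub_eq_zero, he.symm]

variable [IsProbabilityMeasure η]

lemma tsum_meanRow (hη : ∀ᵐ a ∂η, ∑' d, a d = 1) : ∑' d, meanRow η d = 1 := by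
  simp_rw [meanRow]
  rw [← lintegral_tsum fun e => (measurable_pi_apply e).aemeasurable, lintegral_congr_ae hη]
  simp

lemma collision_succ_le_rowMoment (m : ℕ) : collision (meanRow η) (m + 1) ≤ rowMoment η m := by
  refine ENNReal.tsum_le_tsum fun d => ?_
  rw [← lintegral_smoothRow]
  exact sq_lintegral_le η (by fun_prop)

lemma rowMoment_le_collision (hη : ∀ᵐ a ∂η, ∑' d, a d = 1) (m : ℕ) :
    rowMoment η m ≤ collision (meanRow η) m := by
  rw [rowMoment, ← lintegral_tsum fun d => by fun_prop]
  calc ∫⁻ a, ∑' d, smoothRow (meanRow η) m a d ^ 2 ∂η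
      ≤ ∫⁻ _, collision (meanRow η) m ∂η := by
        refine lintegral_mono_ae ?_
        filter_upwards [hη] with a ha
        calc ∑' d, smoothRow (meanRow η) m a d ^ 2
            ≤ ∑' d, ∑' e, a e * walk (meanRow η) m (d - e) ^ 2 :=
              ENNReal.tsum_le_tsum fun d => sq_tsum_le ha _
          _ = ∑' e, a e * collision (meanRow η) m := by
            rw [ENNReal.tsum_comm]
            refine tsum_congr fun e => ?_
            rw [ENNReal.tsum_mul_left]
            congr 1
            exact tsum_sub_right (fun z => walk (meanRow η) m z ^ 2) e
          _ = _ := by rw [ENNReal.tsum_mul_right, ha, one_mul]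
    _ = _ := by simp

lemma tsum_rowMoment_sub_le (hη : ∀ᵐ a ∂η, ∑' d, a d = 1) :
    ∑' m, (rowMoment η m - collision (meanRow η) (m + 1)) ≤ rowMoment η 0 := by
  have hsub (m) : rowMoment η m - collision (meanRow η) (m + 1) +
      collision (meanRow η) (m + 1) = rowMoment η m :=
    tsub_add_cancel_of_le (collision_succ_le_rowMoment m)
  -- the sum telescopes, as `rowMoment η (m + 1) ≤ collision (meanRow η) (m + 1)`
  have h (N : ℕ) : ∑ m ∈ Finset.range (N + 1),
      (rowMoment η m - collision (meanRow η) (m + 1)) + collision (meanRow η) (N + 1) ≤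
        rowMoment η 0 := by
    induction N with
    | zero => simp [hsub]
    | succ N ih =>
      rw [Finset.sum_range_succ, add_assoc, hsub]
      exact (add_le_add_right (rowMoment_le_collision hη _) _).trans ih
  refine ENNReal.tsum_le_of_sum_range_le fun N => ?_
  refine le_trans ?_ (le_self_add.trans (h N))
  exact Finset.sum_le_sum_of_subset (Finset.range_mono (Nat.le_succ N))

/-- A row that is not almost surely a point mass has squared `ℓ²` norm less than one on average. -/
lemma rowMoment_zero_lt_one (hη : ∀ᵐ a ∂η, ∑' d, a d = 1) (hnd : ¬ ∀ᵐ a ∂η, ∃ d, a d = 1) :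
    rowMoment η 0 < 1 := by
  have hle : ∀ᵐ a ∂η, ∀ d, a d ≤ 1 := by
    filter_upwards [hη] with a ha d
    exact (ENNReal.le_tsum d).trans ha.le
  have hsq : ∀ᵐ a ∂η, ∑' d, a d ^ 2 ≤ 1 := by
    filter_upwards [hη, hle] with a ha h1
    rw [← ha]
    refine ENNReal.tsum_le_tsum fun d => ?_
    rw [sq]
    exact mul_le_of_le_one_left zero_le (h1 d)
  have hle1 : ∫⁻ a, ∑' d, a d ^ 2 ∂η ≤ ∫⁻ _, 1 ∂η := lintegral_mono_ae hsq
  rw [rowMoment_zero]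
  refine lt_of_le_of_ne (by simpa using hle1) fun heq => hnd ?_
  have hae : (fun a : ℤ → ℝ≥0∞ => ∑' d, a d ^ 2) =ᵐ[η] fun _ => 1 :=
    ae_eq_of_ae_le_of_lintegral_le hsq (by simp [heq]) aemeasurable_const (by simp [heq])
  filter_upwards [hη, hle, hae] with a ha h1 h2
  by_contra! hne
  obtain ⟨d, hd⟩ : ∃ d, a d ≠ 0 := by
    by_contra! h0
    simp [h0] at ha
  refine absurd (h2.trans ha.symm) (ne_of_lt ?_)
  refine ENNReal.tsum_lt_tsum (i := d) (by rw [h2]; simp) (fun e => ?_) ?_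
  · rw [sq]; exact mul_le_of_le_one_left zero_le (h1 e)
  · rw [sq]
    calc a d * a d < a d * 1 := ENNReal.mul_lt_mul_right hd
          (ne_top_of_le_ne_top ENNReal.one_ne_top (h1 d)) (lt_of_le_of_ne (h1 d) (hne d))
      _ = a d := mul_one _

lemma tendsto_collision_meanRow (hη : ∀ᵐ a ∂η, ∑' d, a d = 1)
    (hnd : ¬ ∀ᵐ a ∂η, ∃ d, a d = 1) : Tendsto (collision (meanRow η)) atTop (𝓝 0) := by
  have hp := tsum_meanRow hη
  by_cases h : ∃ x y, x ≠ y ∧ meanRow η x ≠ 0 ∧ meanRow η y ≠ 0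
  · obtain ⟨x, y, hxy, hx, hy⟩ := h
    exact tendsto_collision hp hxy hx hy
  -- a mean row concentrated at one point forces the collision probability to be one
  exfalso
  push Not at h
  obtain ⟨x, hx⟩ : ∃ x, meanRow η x ≠ 0 := by
    by_contra! h0
    simp [h0] at hp
  have hz (y : ℤ) (hy : y ≠ x) : meanRow η y = 0 := h x y hy.symm hx
  have hx1 : meanRow η x = 1 := by rwa [tsum_eq_single x hz] at hp
  have h1 : 1 ≤ collision (meanRow η) 1 := by
    refine le_trans ?_ (ENNReal.le_tsum x)
    have : walk (meanRow η) 1 x = 1 := by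
      simp only [walk]
      rw [tsum_eq_single x fun y hy => by rw [hz y hy, zero_mul]]
      simp [hx1]
    simp [this]
  exact absurd (h1.trans (collision_succ_le_rowMoment 0))
    (not_le.2 (rowMoment_zero_lt_one hη hnd))

end

section

/-! ### Products of exchange matrices with entries in `[0, ∞]` -/

/-- A two-sided infinite matrix with entries in `[0, ∞]`, for which all sums make sense. -/
abbrev EMat := ℤ → ℤ → ℝ≥0∞

/-- The row vector `x` times the matrix `A`. -/
noncomputable def push (x : ℤ → ℝ≥0∞) (A : EMat) (j : ℤ) : ℝ≥0∞ := ∑' i, x i * A i j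

/-- The product of two matrices. -/
noncomputable def emul (A B : EMat) : EMat := fun i => push (A i) B

/-- `backProd n r` is the product `r (n - 1) * ⋯ * r 1 * r 0`. It has the same law as the product in
the original order, but makes the total mass received by an agent a martingale in `n`. -/
noncomputable def backProd : ℕ → (ℕ → EMat) → EMat
  | 0, _ => fun i j => if i = j then 1 else 0
  | n + 1, r => emul (backProd n fun k => r (k + 1)) (r 0)

@[fun_prop]
lemma measurable_push {Y : Type*} [MeasurableSpace Y] {f : Y → ℤ → ℝ≥0∞} {g : Y → EMat}
    (hf : Measurable f) (hg : Measurable g) : Measurable fun y => push (f y) (g y) := by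
  unfold push; fun_prop

@[fun_prop]
lemma measurable_backProd (n : ℕ) : Measurable (backProd n) := by
  induction n with
  | zero => exact measurable_const
  | succ n ih =>
    have h : backProd (n + 1) = fun r => emul (backProd n fun k => r (k + 1)) (r 0) := rfl
    rw [h]
    unfold emul
    fun_prop

lemma push_push (x : ℤ → ℝ≥0∞) (A B : EMat) : push (push x A) B = push x (emul A B) := by
  funext j
  simp_rw [push, emul, push, ← ENNReal.tsum_mul_left, ← ENNReal.tsum_mul_right]
  rw [ENNReal.tsum_comm]
  simp_rw [mul_assoc]

lemma push_backProd_zero (x : ℤ → ℝ≥0∞) (r : ℕ → EMat) : push x (backProd 0 r) = x := by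
  funext j
  simp [push, backProd, tsum_ite_eq]

lemma push_backProd_succ (x : ℤ → ℝ≥0∞) (n : ℕ) (r : ℕ → EMat) :
    push x (backProd (n + 1) r) = push (push x (backProd n fun k => r (k + 1))) (r 0) := by
  rw [push_push, backProd]

lemma backProd_congr {n : ℕ} {r r' : ℕ → EMat} (h : ∀ k < n, r k = r' k) :
    backProd n r = backProd n r' := by
  induction n generalizing r r' with
  | zero => rfl
  | succ n ih => rw [backProd, backProd, ih fun k hk => h (k + 1) (by omega), h 0 (by omega)]

/-! ### The random environment -/

/-- The law of an exchange matrix whose recentred rows are i.i.d. with law `η`. -/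
noncomputable def exchangeLaw (η : Measure (ℤ → ℝ≥0∞)) : Measure EMat :=
  (Measure.infinitePi fun _ : ℤ => η).map fun a i j => a i (j - i)

/-- The law of an i.i.d. sequence of exchange matrices. -/
noncomputable def envLaw (η : Measure (ℤ → ℝ≥0∞)) : Measure (ℕ → EMat) :=
  Measure.infinitePi fun _ => exchangeLaw η

/-- Put the matrix `A` in front of the sequence `r`. -/
def consMat {X : Type*} (A : X) (r : ℕ → X) : ℕ → X
  | 0 => A
  | n + 1 => r n

variable {η : Measure (ℤ → ℝ≥0∞)}

lemma measurable_uncenter : Measurable fun (a : ℤ → ℤ → ℝ≥0∞) (i j : ℤ) => a i (j - i) := by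
  fun_prop

@[fun_prop]
lemma measurable_consMat {X Y : Type*} [MeasurableSpace X] [MeasurableSpace Y] {f : Y → X}
    {g : Y → ℕ → X} (hf : Measurable f) (hg : Measurable g) :
    Measurable fun y => consMat (f y) (g y) := by
  refine measurable_pi_lambda _ fun n => ?_
  cases n with
  | zero => exact hf
  | succ n => exact (measurable_pi_apply n).comp hg

/-- The sum over a family `ξ` of initial configurations of the expected squared mass at `j`, after
`k` random exchanges followed by `m` exchanges with the mean matrix. -/
noncomputable def secondMoment {α : Type*} (η : Measure (ℤ → ℝ≥0∞)) (ξ : α → ℤ → ℝ≥0∞)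
    (m k : ℕ) (j : ℤ) : ℝ≥0∞ :=
  ∑' α, ∫⁻ r, (∑' i, push (ξ α) (backProd k r) i * walk (meanRow η) m (j - i)) ^ 2 ∂envLaw η

variable {α : Type*}

lemma tsum_mul_walk_zero (p x : ℤ → ℝ≥0∞) (j : ℤ) : ∑' i, x i * walk p 0 (j - i) = x j := by
  rw [tsum_eq_single j]
  · simp [walk]
  · intro i hi
    simp [walk, sub_eq_zero, hi.symm]

lemma secondMoment_zero_left (ξ : α → ℤ → ℝ≥0∞) (k : ℕ) (j : ℤ) :
    secondMoment η ξ 0 k j = ∑' α, ∫⁻ r, push (ξ α) (backProd k r) j ^ 2 ∂envLaw η := by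
  simp_rw [secondMoment, tsum_mul_walk_zero]

variable [IsProbabilityMeasure η]

instance : IsProbabilityMeasure (exchangeLaw η) :=
  Measure.isProbabilityMeasure_map measurable_uncenter.aemeasurable

instance : IsProbabilityMeasure (envLaw η) := by unfold envLaw; infer_instance

lemma lintegral_exchangeLaw_row (i : ℤ) {f : (ℤ → ℝ≥0∞) → ℝ≥0∞} (hf : Measurable f) :
    ∫⁻ A, f (fun d => A i (i + d)) ∂exchangeLaw η = ∫⁻ a, f a ∂η := by
  rw [exchangeLaw, lintegral_map (by fun_prop) measurable_uncenter]
  simp only [add_sub_cancel_left]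
  exact (measurePreserving_eval_infinitePi (fun _ : ℤ => η) i).lintegral_comp hf

lemma indepFun_exchangeLaw {i j : ℤ} (hij : i ≠ j) {f g : (ℤ → ℝ≥0∞) → ℝ≥0∞}
    (hf : Measurable f) (hg : Measurable g) :
    IndepFun (fun A : EMat => f fun d => A i (i + d)) (fun A => g fun d => A j (j + d))
      (exchangeLaw η) := by
  have h : IndepFun (fun a : ℤ → ℤ → ℝ≥0∞ => a i) (fun a => a j)
      (Measure.infinitePi fun _ : ℤ => η) :=
    (iIndepFun_infinitePi (P := fun _ : ℤ => η) (X := fun _ a => a) fun _ => measurable_id).indepFun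
      hij
  have hf' : Measurable fun A : EMat => f fun d => A i (i + d) := hf.comp (by fun_prop)
  have hg' : Measurable fun A : EMat => g fun d => A j (j + d) := hg.comp (by fun_prop)
  rw [exchangeLaw, indepFun_iff_map_prod_eq_prod_map_map hf'.aemeasurable hg'.aemeasurable,
    Measure.map_map (by fun_prop) measurable_uncenter,
    Measure.map_map (by fun_prop) measurable_uncenter,
    Measure.map_map (by fun_prop) measurable_uncenter]
  have h2 := h.comp hf hg
  rw [indepFun_iff_map_prod_eq_prod_map_map (hf.comp (measurable_pi_apply i)).aemeasurable
    (hg.comp (measurable_pi_apply j)).aemeasurable] at h2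
  simpa [Function.comp_def] using h2

lemma map_consMat :
    ((exchangeLaw η).prod (envLaw η)).map (fun q => consMat q.1 q.2) = envLaw η := by
  refine Measure.eq_infinitePi _ fun s t ht => ?_
  classical
  obtain ⟨N, hN⟩ : ∃ N, s ⊆ Finset.range (N + 1) :=
    ⟨s.sup id, fun x hx => Finset.mem_range.2 (Nat.lt_succ_of_le (Finset.le_sup (f := id) hx))⟩
  let t' : ℕ → Set EMat := fun n => if n ∈ s then t n else Set.univ
  have ht' (n) : MeasurableSet (t' n) := by
    simp only [t']; split_ifs
    · exact ht n
    · exact .univ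
  have hprod : ∏ i ∈ s, exchangeLaw η (t i) = ∏ i ∈ Finset.range (N + 1), exchangeLaw η (t' i) := by
    rw [← Finset.prod_subset hN]
    · exact Finset.prod_congr rfl fun i hi => by simp [t', hi]
    · intro i _ hi; simp [t', hi]
  have hset : (fun q : EMat × (ℕ → EMat) => consMat q.1 q.2) ⁻¹' (Set.pi s t) =
      t' 0 ×ˢ Set.pi (Finset.range N) fun n => t' (n + 1) := by
    ext ⟨A, r⟩
    simp only [Set.mem_preimage, Set.mem_pi, Set.mem_prod, Finset.mem_coe, Finset.mem_range]
    constructor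
    · intro h
      refine ⟨?_, fun n _ => ?_⟩
      · by_cases h0 : 0 ∈ s
        · simpa [t', h0, consMat] using h 0 h0
        · simp [t', h0]
      · by_cases h0 : n + 1 ∈ s
        · simpa [t', h0, consMat] using h (n + 1) h0
        · simp [t', h0]
    · rintro ⟨h0, h1⟩ n hn
      cases n with
      | zero => simpa [t', hn, consMat] using h0
      | succ n =>
        have := h1 n (by simpa using hN hn)
        simpa [t', hn, consMat] using this
  rw [Measure.map_apply (by fun_prop) (MeasurableSet.pi s.countable_toSet fun i _ => ht i), hset,
    Measure.prod_prod, envLaw, Measure.infinitePi_pi _ fun i _ => ht' (i + 1), hprod,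
    Finset.prod_range_succ', mul_comm]

lemma lintegral_envLaw {f : EMat → (ℕ → EMat) → ℝ≥0∞} (hf : Measurable (Function.uncurry f)) :
    ∫⁻ r, f (r 0) (fun n => r (n + 1)) ∂envLaw η = ∫⁻ r, ∫⁻ A, f A r ∂exchangeLaw η ∂envLaw η := by
  have h1 : Measurable fun r : ℕ → EMat => f (r 0) fun n => r (n + 1) :=
    hf.comp (f := fun r : ℕ → EMat => (r 0, fun n => r (n + 1))) (by fun_prop)
  rw [← map_consMat, lintegral_map h1 (by fun_prop), map_consMat]
  exact lintegral_prod_symm _ hf.aemeasurable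

lemma lintegral_exchangeLaw_entry (i j : ℤ) :
    ∫⁻ A, A i j ∂exchangeLaw η = meanRow η (j - i) := by
  have := lintegral_exchangeLaw_row (η := η) i (f := fun a => a (j - i)) (by fun_prop)
  simpa [meanRow] using this

/-! ### Second moments -/

/-- The expected square at `j` of the mass obtained from `x` by one exchange with a random matrix
followed by `m` exchanges with the mean matrix. -/
lemma lintegral_sq_push_walk (x : ℤ → ℝ≥0∞) (m : ℕ) (j : ℤ) :
    ∫⁻ A, (∑' i, push x A i * walk (meanRow η) m (j - i)) ^ 2 ∂exchangeLaw η +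
        ∑' l, x l ^ 2 * walk (meanRow η) (m + 1) (j - l) ^ 2 =
      (∑' l, x l * walk (meanRow η) (m + 1) (j - l)) ^ 2 +
        ∑' l, x l ^ 2 * ∫⁻ a, smoothRow (meanRow η) m a (j - l) ^ 2 ∂η := by
  let Z : ℤ → EMat → ℝ≥0∞ := fun l A => smoothRow (meanRow η) m (fun d => A l (l + d)) (j - l)
  have hZ (l) : Measurable (Z l) :=
    (measurable_smoothRow (meanRow η) m (j - l)).comp (by fun_prop)
  have hi : Pairwise fun l l' => IndepFun (Z l) (Z l') (exchangeLaw η) := fun l l' h =>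
    indepFun_exchangeLaw h (measurable_smoothRow _ _ _) (measurable_smoothRow _ _ _)
  have h1 (A : EMat) : ∑' i, push x A i * walk (meanRow η) m (j - i) = ∑' l, x l * Z l A := by
    simp_rw [push, ← ENNReal.tsum_mul_right]
    rw [ENNReal.tsum_comm]
    refine tsum_congr fun l => ?_
    simp_rw [Z, smoothRow, ← ENNReal.tsum_mul_left]
    rw [← (Equiv.addLeft l).tsum_eq]
    refine tsum_congr fun d => ?_
    simp only [Equiv.coe_addLeft, mul_assoc, sub_sub]
  have h2 (l) : ∫⁻ A, Z l A ∂exchangeLaw η = walk (meanRow η) (m + 1) (j - l) := by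
    rw [← lintegral_smoothRow]
    exact lintegral_exchangeLaw_row l (measurable_smoothRow _ _ _)
  have h3 (l) : ∫⁻ A, Z l A ^ 2 ∂exchangeLaw η =
      ∫⁻ a, smoothRow (meanRow η) m a (j - l) ^ 2 ∂η :=
    lintegral_exchangeLaw_row l ((measurable_smoothRow _ _ _).pow_const 2)
  have := lintegral_sq_tsum_of_indep hZ hi x
  simp_rw [h2, h3] at this
  simp_rw [h1]
  exact this

lemma secondMoment_zero_right (ξ : α → ℤ → ℝ≥0∞) (m : ℕ) (j : ℤ) :
    secondMoment η ξ m 0 j = ∑' α, (∑' i, ξ α i * walk (meanRow η) m (j - i)) ^ 2 := by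
  simp_rw [secondMoment, push_backProd_zero]
  simp

lemma secondMoment_succ (ξ : α → ℤ → ℝ≥0∞) (m k : ℕ) (j : ℤ) :
    secondMoment η ξ m (k + 1) j +
        ∑' l, secondMoment η ξ 0 k l * walk (meanRow η) (m + 1) (j - l) ^ 2 =
      secondMoment η ξ (m + 1) k j +
        ∑' l, secondMoment η ξ 0 k l * ∫⁻ a, smoothRow (meanRow η) m a (j - l) ^ 2 ∂η := by
  simp_rw [secondMoment_zero_left, ← ENNReal.tsum_mul_right]
  rw [ENNReal.tsum_comm, ENNReal.tsum_comm (α := ℤ), secondMoment, secondMoment,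
    ← ENNReal.tsum_add, ← ENNReal.tsum_add]
  refine tsum_congr fun a => ?_
  have hm (i : ℤ) : Measurable fun r => push (ξ a) (backProd k r) i :=
    (measurable_pi_apply i).comp (measurable_push measurable_const (measurable_backProd k))
  have hs (c : ℤ → ℝ≥0∞) : ∑' l, (∫⁻ r, push (ξ a) (backProd k r) l ^ 2 ∂envLaw η) * c l =
      ∫⁻ r, ∑' l, push (ξ a) (backProd k r) l ^ 2 * c l ∂envLaw η := by
    rw [lintegral_tsum fun l => (((hm l).pow_const 2).mul_const _).aemeasurable]
    exact tsum_congr fun l => (lintegral_mul_const _ ((hm l).pow_const 2)).symm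
  have hc (c : ℤ → ℝ≥0∞) :
      Measurable fun r => ∑' l, push (ξ a) (backProd k r) l ^ 2 * c l :=
    Measurable.tsum fun l => ((hm l).pow_const 2).mul_const _
  have hstep : ∫⁻ r, (∑' i, push (ξ a) (backProd (k + 1) r) i * walk (meanRow η) m (j - i)) ^ 2
        ∂envLaw η = ∫⁻ r, ∫⁻ A, (∑' i, push (push (ξ a) (backProd k r)) A i *
          walk (meanRow η) m (j - i)) ^ 2 ∂exchangeLaw η ∂envLaw η := by
    simp_rw [push_backProd_succ]
    refine lintegral_envLaw (f := fun A r =>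
      (∑' i, push (push (ξ a) (backProd k r)) A i * walk (meanRow η) m (j - i)) ^ 2) ?_
    have h0 : Measurable fun q : EMat × (ℕ → EMat) => push (push (ξ a) (backProd k q.2)) q.1 := by
      fun_prop
    have h1 (i : ℤ) := (measurable_pi_apply i).comp h0
    exact (Measurable.tsum fun i => (h1 i).mul_const _).pow_const 2
  rw [hstep, hs, hs, ← lintegral_add_right _ (hc _), ← lintegral_add_right _ (hc _)]
  exact lintegral_congr fun r => lintegral_sq_push_walk _ m j

end

section

variable {η : Measure (ℤ → ℝ≥0∞)}

/-! ### The total mass received by an agent -/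

/-- The mass at `j` after `n` exchanges started from the constant configuration, for the product of
the exchange matrices in reversed order. -/
noncomputable def mass (n : ℕ) (r : ℕ → EMat) (j : ℤ) : ℝ≥0∞ := ∑' i, backProd n r i j

lemma mass_eq_push (n : ℕ) (r : ℕ → EMat) : mass n r = push (fun _ => 1) (backProd n r) := by
  funext j; simp [mass, push]

lemma mass_zero (r : ℕ → EMat) : mass 0 r = fun _ => 1 := by
  rw [mass_eq_push, push_backProd_zero]

lemma mass_succ (n : ℕ) (r : ℕ → EMat) :
    mass (n + 1) r = push (mass n fun k => r (k + 1)) (r 0) := by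
  rw [mass_eq_push, mass_eq_push, push_backProd_succ]

@[fun_prop]
lemma measurable_mass (n : ℕ) : Measurable (mass n) := by
  have h : mass n = fun r => push (fun _ => 1) (backProd n r) := funext (mass_eq_push n)
  rw [h]
  fun_prop

@[fun_prop]
lemma measurable_mass_apply (n : ℕ) (j : ℤ) : Measurable fun r => mass n r j :=
  (measurable_pi_apply j).comp (measurable_mass n)

/-- The second moment of the mass at a site after `n` exchanges. -/
noncomputable def massMoment (η : Measure (ℤ → ℝ≥0∞)) (n : ℕ) : ℝ≥0∞ :=
  ∫⁻ r, mass n r 0 ^ 2 ∂envLaw η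

lemma secondMoment_one_eq (n : ℕ) (j : ℤ) :
    secondMoment η (fun (_ : Unit) _ => 1) 0 n j = ∫⁻ r, mass n r j ^ 2 ∂envLaw η := by
  rw [secondMoment_zero_left]
  simp [mass_eq_push]

/-! ### The renewal equation for second moments -/

variable [IsProbabilityMeasure η] {α : Type*}

/-- The rate at which the squared mass of one agent feeds the second moment `m + 1` steps later. -/
noncomputable def feedback (η : Measure (ℤ → ℝ≥0∞)) (m : ℕ) : ℝ≥0∞ :=
  rowMoment η m - collision (meanRow η) (m + 1)

lemma secondMoment_succ_eq (hη : ∀ᵐ a ∂η, ∑' d, a d = 1) {ξ : α → ℤ → ℝ≥0∞} {m k : ℕ}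
    {c d : ℝ≥0∞} (hc : c ≠ ∞) (h0 : ∀ j, secondMoment η ξ 0 k j = c)
    (h1 : ∀ j, secondMoment η ξ (m + 1) k j = d) (j : ℤ) :
    secondMoment η ξ m (k + 1) j = d + c * feedback η m := by
  have h := secondMoment_succ (η := η) ξ m k j
  simp_rw [h0, h1, ENNReal.tsum_mul_left] at h
  have e1 : ∑' l, walk (meanRow η) (m + 1) (j - l) ^ 2 = collision (meanRow η) (m + 1) :=
    tsum_sub_left (fun z => walk (meanRow η) (m + 1) z ^ 2) j
  have e2 : ∑' l, ∫⁻ a, smoothRow (meanRow η) m a (j - l) ^ 2 ∂η = rowMoment η m :=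
    tsum_sub_left (fun z => ∫⁻ a, smoothRow (meanRow η) m a z ^ 2 ∂η) j
  rw [e1, e2, ← tsub_add_cancel_of_le (collision_succ_le_rowMoment (η := η) m), mul_add,
    ← add_assoc] at h
  refine (ENNReal.add_left_inj ?_).1 h
  exact ENNReal.mul_ne_top hc (ne_top_of_le_ne_top ENNReal.one_ne_top
    (collision_le_one (tsum_meanRow hη) _))

lemma feedback_ne_top (hη : ∀ᵐ a ∂η, ∑' d, a d = 1) (m : ℕ) : feedback η m ≠ ∞ :=
  ne_top_of_le_ne_top ENNReal.one_ne_top (tsub_le_self.trans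
    ((rowMoment_le_collision hη m).trans (collision_le_one (tsum_meanRow hη) m)))

/-- If the mean evolution makes the second moments translation invariant, so does the random one. -/
lemma secondMoment_ne_top_and_eq (hη : ∀ᵐ a ∂η, ∑' d, a d = 1) {ξ : α → ℤ → ℝ≥0∞} {h : ℕ → ℝ≥0∞}
    (hh : ∀ m, h m ≠ ∞) (hξ : ∀ m j, secondMoment η ξ m 0 j = h m) (k m : ℕ) :
    secondMoment η ξ m k 0 ≠ ∞ ∧ ∀ j, secondMoment η ξ m k j = secondMoment η ξ m k 0 := by
  induction k generalizing m with
  | zero => exact ⟨by rw [hξ]; exact hh m, fun j => by rw [hξ, hξ]⟩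
  | succ k ih =>
    have key := secondMoment_succ_eq hη (ih 0).1 (ih 0).2 (ih (m + 1)).2
    refine ⟨?_, fun j => by rw [key, key]⟩
    rw [key]
    exact ENNReal.add_ne_top.2 ⟨(ih _).1, ENNReal.mul_ne_top (ih 0).1 (feedback_ne_top hη m)⟩

/-- The second moments solve a renewal equation with interarrival weights `feedback η`. -/
lemma secondMoment_renewal (hη : ∀ᵐ a ∂η, ∑' d, a d = 1) {ξ : α → ℤ → ℝ≥0∞} {h : ℕ → ℝ≥0∞}
    (hh : ∀ m, h m ≠ ∞) (hξ : ∀ m j, secondMoment η ξ m 0 j = h m) (n : ℕ) :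
    secondMoment η ξ 0 n 0 = h n +
      ∑ i ∈ Finset.range n, secondMoment η ξ 0 i 0 * feedback η (n - 1 - i) := by
  have hr : ∀ m k, secondMoment η ξ m (k + 1) 0 =
      secondMoment η ξ (m + 1) k 0 + secondMoment η ξ 0 k 0 * feedback η m := fun m k =>
    secondMoment_succ_eq hη (secondMoment_ne_top_and_eq hη hh hξ k 0).1
      (secondMoment_ne_top_and_eq hη hh hξ k 0).2
      (secondMoment_ne_top_and_eq hη hh hξ k (m + 1)).2 0
  have := renewal_expand (H := fun m k => secondMoment η ξ m k 0) hr 0 n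
  simpa [hξ] using this

/-- The sum of the squares of the fractions of their mass that the agents pass on to `j` in `n`
steps tends to zero in mean. -/
lemma tendsto_sum_sq_backProd (hη : ∀ᵐ a ∂η, ∑' d, a d = 1) (hnd : ¬ ∀ᵐ a ∂η, ∃ d, a d = 1)
    (j : ℤ) :
    Tendsto (fun n => ∑' i, ∫⁻ r, backProd n r i j ^ 2 ∂envLaw η) atTop (𝓝 0) := by
  classical
  let ξ : ℤ → ℤ → ℝ≥0∞ := fun i k => if i = k then 1 else 0
  have hpush (i : ℤ) (A : EMat) : push (ξ i) A = A i := by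
    funext k
    simp [push, ξ]
  have hp := tsum_meanRow hη
  have hξ (m : ℕ) (j : ℤ) : secondMoment η ξ m 0 j = collision (meanRow η) m := by
    rw [secondMoment_zero_right]
    have (i : ℤ) : ∑' l, ξ i l * walk (meanRow η) m (j - l) = walk (meanRow η) m (j - i) := by
      simp [ξ]
    simp_rw [this]
    exact tsum_sub_left (fun z => walk (meanRow η) m z ^ 2) j
  have hh (m : ℕ) : collision (meanRow η) m ≠ ∞ :=
    ne_top_of_le_ne_top ENNReal.one_ne_top (collision_le_one hp m)
  have h1 := renewal_tendsto_zero (rowMoment_zero_lt_one hη hnd) (tsum_rowMoment_sub_le hη)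
    (tendsto_collision_meanRow hη hnd) (collision_le_one hp) (secondMoment_renewal hη hh hξ)
  refine h1.congr fun n => ?_
  rw [← (secondMoment_ne_top_and_eq hη hh hξ n 0).2 j, secondMoment_zero_left]
  simp_rw [hpush]

/-! ### The martingale of masses -/

lemma secondMoment_one (hη : ∀ᵐ a ∂η, ∑' d, a d = 1) (m : ℕ) (j : ℤ) :
    secondMoment η (fun (_ : Unit) _ => 1) m 0 j = 1 := by
  rw [secondMoment_zero_right]
  simp_rw [one_mul, tsum_sub_left (walk (meanRow η) m), tsum_walk (tsum_meanRow hη)]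
  simp

lemma lintegral_mass_sq (hη : ∀ᵐ a ∂η, ∑' d, a d = 1) (n : ℕ) (j : ℤ) :
    ∫⁻ r, mass n r j ^ 2 ∂envLaw η = massMoment η n := by
  rw [← secondMoment_one_eq, massMoment, ← secondMoment_one_eq]
  exact (secondMoment_ne_top_and_eq hη (fun _ => ENNReal.one_ne_top) (secondMoment_one hη) n 0).2 j

lemma massMoment_le (hη : ∀ᵐ a ∂η, ∑' d, a d = 1) (hnd : ¬ ∀ᵐ a ∂η, ∃ d, a d = 1) (n : ℕ) :
    massMoment η n ≤ (1 - rowMoment η 0)⁻¹ := by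
  have h := renewal_bounded (h := 1) (rowMoment_zero_lt_one hη hnd) (tsum_rowMoment_sub_le hη)
    (fun n => (secondMoment_renewal hη (fun _ => ENNReal.one_ne_top)
      (secondMoment_one hη) n).le) n
  rwa [secondMoment_one_eq, one_mul] at h

lemma massMoment_ne_top (hη : ∀ᵐ a ∂η, ∑' d, a d = 1) (hnd : ¬ ∀ᵐ a ∂η, ∃ d, a d = 1) (n : ℕ) :
    massMoment η n ≠ ∞ := by
  refine ne_top_of_le_ne_top ?_ (massMoment_le hη hnd n)
  rw [ENNReal.inv_ne_top]
  exact (tsub_pos_of_lt (rowMoment_zero_lt_one hη hnd)).ne'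

lemma lintegral_mass (hη : ∀ᵐ a ∂η, ∑' d, a d = 1) (n : ℕ) (j : ℤ) :
    ∫⁻ r, mass n r j ∂envLaw η = 1 := by
  induction n generalizing j with
  | zero => simp [mass_zero]
  | succ n ih =>
    simp_rw [mass_succ, push]
    rw [lintegral_envLaw (f := fun A r => ∑' i, mass n r i * A i j)
      (by unfold Function.uncurry; fun_prop)]
    have (r : ℕ → EMat) : ∫⁻ A, ∑' i, mass n r i * A i j ∂exchangeLaw η =
        ∑' i, mass n r i * meanRow η (j - i) := by
      rw [lintegral_tsum fun i => Measurable.aemeasurable (by fun_prop)]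
      refine tsum_congr fun i => ?_
      rw [lintegral_const_mul _ (by fun_prop), lintegral_exchangeLaw_entry]
    simp_rw [this]
    rw [lintegral_tsum fun i => by fun_prop]
    simp_rw [lintegral_mul_const _ (measurable_mass_apply n _), ih, one_mul,
      tsum_sub_left (meanRow η)]
    exact tsum_meanRow hη

/-- The masses received after `m ≤ n` steps satisfy the covariance identity of a martingale. -/
lemma lintegral_mass_mul_mass (hη : ∀ᵐ a ∂η, ∑' d, a d = 1) (m n : ℕ) (i j : ℤ) :
    ∫⁻ r, mass (m + n) r i * mass m r j ∂envLaw η =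
      ∫⁻ r, mass m r i * mass m r j ∂envLaw η := by
  induction m generalizing i j with
  | zero => simp [mass_zero, lintegral_mass hη]
  | succ m ih =>
    have step (a : ℕ) : ∫⁻ r, mass (a + 1) r i * mass (m + 1) r j ∂envLaw η =
        ∑' k, ∑' l, (∫⁻ r, mass a r k * mass m r l ∂envLaw η) *
          ∫⁻ A, A k i * A l j ∂exchangeLaw η := by
      simp_rw [mass_succ, push]
      rw [lintegral_envLaw (f := fun A r => (∑' k, mass a r k * A k i) *
        ∑' l, mass m r l * A l j) (by unfold Function.uncurry; fun_prop)]
      have (r : ℕ → EMat) : ∫⁻ A, (∑' k, mass a r k * A k i) *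
          ∑' l, mass m r l * A l j ∂exchangeLaw η =
          ∑' k, ∑' l, mass a r k * mass m r l * ∫⁻ A, A k i * A l j ∂exchangeLaw η := by
        simp_rw [← ENNReal.tsum_mul_right, ← ENNReal.tsum_mul_left]
        rw [lintegral_tsum fun i => by fun_prop]
        refine tsum_congr fun k => ?_
        rw [lintegral_tsum fun i => by fun_prop]
        refine tsum_congr fun l => ?_
        rw [← lintegral_const_mul _ (by fun_prop)]
        exact lintegral_congr fun A => by ring
      simp_rw [this]
      rw [lintegral_tsum fun i => by fun_prop]
      refine tsum_congr fun k => ?_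
      rw [lintegral_tsum fun i => by fun_prop]
      exact tsum_congr fun l => lintegral_mul_const _ (by fun_prop)
    rw [Nat.add_right_comm, step, step]
    simp_rw [ih]

lemma lintegral_sqDist_mass (hη : ∀ᵐ a ∂η, ∑' d, a d = 1) (hnd : ¬ ∀ᵐ a ∂η, ∃ d, a d = 1)
    (m n : ℕ) (j : ℤ) :
    ∫⁻ r, sqDist (mass (m + n) r j) (mass m r j) ∂envLaw η + massMoment η m =
      massMoment η (m + n) := by
  have h : ∫⁻ r, (mass (m + n) r j ^ 2 + mass m r j ^ 2) ∂envLaw η =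
      ∫⁻ r, (2 * (mass (m + n) r j * mass m r j) +
        sqDist (mass (m + n) r j) (mass m r j)) ∂envLaw η :=
    lintegral_congr fun r => sq_add_sq_eq _ _
  rw [lintegral_add_left (by fun_prop), lintegral_add_left (by fun_prop),
    lintegral_const_mul _ (by fun_prop), lintegral_mass_mul_mass hη] at h
  simp_rw [← sq] at h
  rw [lintegral_mass_sq hη, lintegral_mass_sq hη, two_mul] at h
  refine (ENNReal.add_left_inj (massMoment_ne_top hη hnd m)).1 ?_
  rw [h]
  ring

end

section

/-! ### The limit mass -/

lemma enorm_sub_sq {x y : ℝ} (hx : 0 ≤ x) (hy : 0 ≤ y) :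
    ‖x - y‖ₑ ^ 2 = sqDist (ENNReal.ofReal x) (ENNReal.ofReal y) := by
  rw [sqDist_ofReal hx hy, Real.enorm_eq_ofReal_abs, ← ENNReal.ofReal_pow (abs_nonneg _), sq_abs]

lemma eLpNorm_two_eq {Ω : Type*} [MeasurableSpace Ω] (P : Measure Ω) (f : Ω → ℝ) :
    eLpNorm f 2 P = (∫⁻ ω, ‖f ω‖ₑ ^ 2 ∂P) ^ (1 / 2 : ℝ) := by
  rw [eLpNorm_eq_lintegral_rpow_enorm_toReal (by simp) (by simp)]
  simp

/-- Completeness of `L²`, for `[0, ∞]`-valued variables and the squared distance `sqDist`. The limit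
is chosen finite and non-negative everywhere. -/
lemma exists_limit_of_lintegral_sqDist_le {Ω : Type*} [MeasurableSpace Ω] {P : Measure Ω}
    {F : ℕ → Ω → ℝ≥0∞} (hF : ∀ n, Measurable (F n)) (hF2 : ∀ n, ∫⁻ ω, F n ω ^ 2 ∂P ≠ ∞)
    {b : ℕ → ℝ≥0∞} (hb : Tendsto b atTop (𝓝 0))
    (hFb : ∀ m n, ∫⁻ ω, sqDist (F (m + n) ω) (F m ω) ∂P ≤ b m) :
    ∃ G : Ω → ℝ, Measurable G ∧ (∀ ω, 0 ≤ G ω) ∧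
      ∀ n, ∫⁻ ω, sqDist (F n ω) (ENNReal.ofReal (G ω)) ∂P ≤ 2 * b n := by
  have hfin (n) : ∀ᵐ ω ∂P, F n ω ≠ ∞ := by
    filter_upwards [ae_lt_top ((hF n).pow_const 2) (hF2 n)] with ω h h'
    simp [h'] at h
  have hFr (n) : ∀ᵐ ω ∂P, ENNReal.ofReal (F n ω).toReal = F n ω := by
    filter_upwards [hfin n] with ω h
    exact ENNReal.ofReal_toReal h
  have hmem (n) : MemLp (fun ω => (F n ω).toReal) 2 P := by
    refine ⟨(hF n).ennreal_toReal.aestronglyMeasurable, ?_⟩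
    rw [eLpNorm_two_eq]
    refine ENNReal.rpow_lt_top_of_nonneg (by norm_num) ?_
    rw [lintegral_congr_ae (g := fun ω => F n ω ^ 2)]
    · exact hF2 n
    · filter_upwards [hFr n] with ω h
      rw [Real.enorm_eq_ofReal ENNReal.toReal_nonneg, h]
  have hdist (n m) : ∫⁻ ω, ‖(F n ω).toReal - (F m ω).toReal‖ₑ ^ 2 ∂P =
      ∫⁻ ω, sqDist (F n ω) (F m ω) ∂P := by
    refine lintegral_congr_ae ?_
    filter_upwards [hFr n, hFr m] with ω h h'
    rw [enorm_sub_sq ENNReal.toReal_nonneg ENNReal.toReal_nonneg, h, h']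
  have hcauchy : CauchySeq fun n => (hmem n).toLp := by
    rw [EMetric.cauchySeq_iff_le_tendsto_0]
    refine ⟨fun N => (4 * b N) ^ (1 / 2 : ℝ), fun n m N hn hm => ?_, ?_⟩
    · rw [Lp.edist_toLp_toLp, eLpNorm_two_eq]
      refine ENNReal.rpow_le_rpow ?_ (by norm_num)
      obtain ⟨n', rfl⟩ := Nat.exists_eq_add_of_le hn
      obtain ⟨m', rfl⟩ := Nat.exists_eq_add_of_le hm
      calc ∫⁻ ω, ‖((fun ω => (F (N + n') ω).toReal) - fun ω => (F (N + m') ω).toReal) ω‖ₑ ^ 2 ∂P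
          = ∫⁻ ω, sqDist (F (N + n') ω) (F (N + m') ω) ∂P := hdist _ _
        _ ≤ 2 * ∫⁻ ω, sqDist (F (N + n') ω) (F N ω) ∂P +
            2 * ∫⁻ ω, sqDist (F N ω) (F (N + m') ω) ∂P :=
          lintegral_sqDist_triangle (hF _) (hF _) (hF _)
        _ = 2 * ∫⁻ ω, sqDist (F (N + n') ω) (F N ω) ∂P +
            2 * ∫⁻ ω, sqDist (F (N + m') ω) (F N ω) ∂P := by
          simp_rw [sqDist_comm (F N _)]
        _ ≤ 2 * b N + 2 * b N := by gcongr <;> exact hFb _ _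
        _ = 4 * b N := by ring
    · have h1 := ENNReal.Tendsto.const_mul (a := 4) hb (Or.inr (by simp))
      have h2 := ((ENNReal.continuous_rpow_const (y := (1 / 2 : ℝ))).tendsto _).comp h1
      simpa [Function.comp_def] using h2
  obtain ⟨g, hg⟩ := cauchySeq_tendsto_of_complete hcauchy
  have hgm : Measurable g := (Lp.stronglyMeasurable g).measurable
  refine ⟨fun ω => max (g ω) 0, hgm.max measurable_const, fun ω => le_max_right _ _, fun n => ?_⟩
  rw [Lp.tendsto_Lp_iff_tendsto_eLpNorm'] at hg
  have hlim : Tendsto (fun N => ∫⁻ ω, sqDist (F N ω) (ENNReal.ofReal (max (g ω) 0)) ∂P) atTop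
      (𝓝 0) := by
    have h1 : Tendsto (fun N => eLpNorm ((hmem N).toLp - g : Lp ℝ 2 P) 2 P ^ 2) atTop (𝓝 0) := by
      have := ENNReal.Tendsto.pow (n := 2) (hg.congr fun N =>
        eLpNorm_congr_ae (Lp.coeFn_sub ((hmem N).toLp) g).symm)
      simpa using this
    refine tendsto_of_tendsto_of_tendsto_of_le_of_le tendsto_const_nhds h1 (fun _ => zero_le)
      fun N => ?_
    rw [eLpNorm_two_eq, ← ENNReal.rpow_natCast, ← ENNReal.rpow_mul]
    simp only [one_div, Nat.cast_ofNat, isUnit_iff_ne_zero, ne_eq, OfNat.ofNat_ne_zero,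
      not_false_eq_true, IsUnit.inv_mul_cancel, ENNReal.rpow_one]
    refine lintegral_mono_ae ?_
    filter_upwards [hFr N, Lp.coeFn_sub ((hmem N).toLp) g, (hmem N).coeFn_toLp] with ω h1 h2 h3
    rw [h2, Pi.sub_apply, h3]
    nth_rw 1 [← h1]
    rw [← enorm_sub_sq ENNReal.toReal_nonneg (le_max_right _ _)]
    have h4 : ‖(F N ω).toReal - max (g ω) 0‖ₑ ≤ ‖(F N ω).toReal - g ω‖ₑ := by
      rw [enorm_le_iff_norm_le, Real.norm_eq_abs, Real.norm_eq_abs]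
      have h5 := abs_max_sub_max_le_abs (F N ω).toReal (g ω) 0
      rwa [max_eq_left ENNReal.toReal_nonneg] at h5
    gcongr
  have hbound (N : ℕ) : ∫⁻ ω, sqDist (F n ω) (ENNReal.ofReal (max (g ω) 0)) ∂P ≤
      2 * b n + 2 * ∫⁻ ω, sqDist (F (n + N) ω) (ENNReal.ofReal (max (g ω) 0)) ∂P := by
    refine (lintegral_sqDist_triangle (hF n) (hF (n + N))
      (hgm.max measurable_const).ennreal_ofReal).trans ?_
    simp_rw [sqDist_comm (F n _)]
    gcongr
    exact hFb _ _
  have h1 : Tendsto (fun N => 2 * b n +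
      2 * ∫⁻ ω, sqDist (F (n + N) ω) (ENNReal.ofReal (max (g ω) 0)) ∂P) atTop (𝓝 (2 * b n)) := by
    have h2 := hlim.comp (tendsto_add_atTop_nat n)
    have h3 := tendsto_const_nhds (x := 2 * b n).add
      (ENNReal.Tendsto.const_mul (a := 2) h2 (Or.inr (by simp)))
    simpa [add_comm n] using h3
  exact ge_of_tendsto' h1 hbound

/-- The distance of two points of `[0, ∞]`. -/
noncomputable def absDist (a b : ℝ≥0∞) : ℝ≥0∞ := (a - b) + (b - a)

lemma absDist_comm (a b : ℝ≥0∞) : absDist a b = absDist b a := add_comm _ _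

@[fun_prop]
lemma measurable_absDist {Ω : Type*} [MeasurableSpace Ω] {f g : Ω → ℝ≥0∞} (hf : Measurable f)
    (hg : Measurable g) : Measurable fun ω => absDist (f ω) (g ω) := by
  unfold absDist; fun_prop

lemma absDist_triangle (a b c : ℝ≥0∞) : absDist a c ≤ absDist a b + absDist b c := by
  unfold absDist
  calc (a - c) + (c - a) ≤ ((a - b) + (b - c)) + ((c - b) + (b - a)) := by
        gcongr <;> exact tsub_le_tsub_add_tsub
    _ = _ := by ring

lemma le_add_absDist (a b : ℝ≥0∞) : a ≤ b + absDist a b :=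
  le_add_tsub.trans (by unfold absDist; gcongr; exact le_self_add)

lemma eq_of_absDist_eq_zero {a b : ℝ≥0∞} (h : absDist a b = 0) : a = b := by
  simp only [absDist, add_eq_zero, tsub_eq_zero_iff_le] at h
  exact le_antisymm h.1 h.2

lemma absDist_sq (a b : ℝ≥0∞) : absDist a b ^ 2 = sqDist a b := by
  unfold absDist sqDist
  rcases le_total a b with h | h <;> simp [tsub_eq_zero_of_le h]

lemma absDist_push_le (x y : ℤ → ℝ≥0∞) (A : EMat) (j : ℤ) :
    absDist (push x A j) (push y A j) ≤ ∑' i, absDist (x i) (y i) * A i j := by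
  have h (x y : ℤ → ℝ≥0∞) : push x A j - push y A j ≤ ∑' i, (x i - y i) * A i j := by
    rw [tsub_le_iff_left, push, push, ← ENNReal.tsum_add]
    refine ENNReal.tsum_le_tsum fun i => ?_
    rw [← add_mul]
    gcongr
    exact le_add_tsub
  simp_rw [absDist, add_mul, ENNReal.tsum_add]
  exact add_le_add (h x y) (h y x)

lemma lintegral_absDist_le {Ω : Type*} [MeasurableSpace Ω] {P : Measure Ω} [IsProbabilityMeasure P]
    {f g : Ω → ℝ≥0∞} (hf : Measurable f) (hg : Measurable g) :
    ∫⁻ ω, absDist (f ω) (g ω) ∂P ≤ (∫⁻ ω, sqDist (f ω) (g ω) ∂P) ^ (1 / 2 : ℝ) := by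
  have h := sq_lintegral_le P (measurable_absDist hf hg)
  simp_rw [absDist_sq] at h
  calc _ = ((∫⁻ ω, absDist (f ω) (g ω) ∂P) ^ 2) ^ (1 / 2 : ℝ) := by
        rw [← ENNReal.rpow_natCast, ← ENNReal.rpow_mul]; simp
    _ ≤ _ := ENNReal.rpow_le_rpow h (by norm_num)

variable {η : Measure (ℤ → ℝ≥0∞)}

/-- `Ξ r j` is the `L²` limit of the masses at `j`, uniformly in `j`, under the law of an i.i.d.
sequence of exchange matrices. -/
structure IsLimitMass (η : Measure (ℤ → ℝ≥0∞)) (Ξ : (ℕ → EMat) → ℤ → ℝ) : Prop where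
  measurable : Measurable Ξ
  nonneg : ∀ r j, 0 ≤ Ξ r j
  exists_rate : ∃ e : ℕ → ℝ≥0∞, Tendsto e atTop (𝓝 0) ∧
    ∀ n j, ∫⁻ r, sqDist (mass n r j) (ENNReal.ofReal (Ξ r j)) ∂envLaw η ≤ e n

variable {Ξ : (ℕ → EMat) → ℤ → ℝ}

lemma IsLimitMass.measurable_ofReal (h : IsLimitMass η Ξ) (j : ℤ) :
    Measurable fun r => ENNReal.ofReal (Ξ r j) :=
  ((measurable_pi_apply j).comp h.measurable).ennreal_ofReal

variable [IsProbabilityMeasure η]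

lemma exists_isLimitMass (hη : ∀ᵐ a ∂η, ∑' d, a d = 1) (hnd : ¬ ∀ᵐ a ∂η, ∃ d, a d = 1) :
    ∃ Ξ, IsLimitMass η Ξ := by
  have hmono : Monotone (massMoment η) := monotone_nat_of_le_succ fun n => by
    rw [← lintegral_sqDist_mass hη hnd n 1 0]; exact le_add_self
  set C := ⨆ n, massMoment η n
  have hC : Tendsto (massMoment η) atTop (𝓝 C) := tendsto_atTop_iSup hmono
  have hCfin : C ≠ ∞ := by
    refine ne_top_of_le_ne_top ?_ (iSup_le (massMoment_le hη hnd))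
    rw [ENNReal.inv_ne_top]
    exact (tsub_pos_of_lt (rowMoment_zero_lt_one hη hnd)).ne'
  have hb : Tendsto (fun n => C - massMoment η n) atTop (𝓝 0) := by
    simpa using ENNReal.Tendsto.sub tendsto_const_nhds hC (Or.inl hCfin)
  have hlim (j : ℤ) := exists_limit_of_lintegral_sqDist_le (P := envLaw η)
    (F := fun n r => mass n r j) (fun n => by fun_prop)
    (fun n => by rw [lintegral_mass_sq hη]; exact massMoment_ne_top hη hnd n) hb
    (fun m n => by
      refine ENNReal.le_sub_of_add_le_right (massMoment_ne_top hη hnd m) ?_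
      rw [lintegral_sqDist_mass hη hnd]
      exact le_iSup (massMoment η) _)
  choose G hGm hG0 hG using hlim
  refine ⟨fun r j => G j r, measurable_pi_lambda _ hGm, fun r j => hG0 j r,
    fun n => 2 * (C - massMoment η n), ?_, fun n j => hG j n⟩
  simpa using ENNReal.Tendsto.const_mul (a := 2) hb (Or.inr (by simp))

lemma IsLimitMass.exists_absDist_rate (h : IsLimitMass η Ξ) :
    ∃ e : ℕ → ℝ≥0∞, Tendsto e atTop (𝓝 0) ∧
      ∀ n j, ∫⁻ r, absDist (mass n r j) (ENNReal.ofReal (Ξ r j)) ∂envLaw η ≤ e n := by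
  obtain ⟨e, he, hle⟩ := h.exists_rate
  refine ⟨fun n => e n ^ (1 / 2 : ℝ), ?_, fun n j => ?_⟩
  · simpa [Function.comp_def] using
      ((ENNReal.continuous_rpow_const (y := (1 / 2 : ℝ))).tendsto _).comp he
  · exact (lintegral_absDist_le (by fun_prop) (h.measurable_ofReal j)).trans
      (ENNReal.rpow_le_rpow (hle n j) (by norm_num))

lemma IsLimitMass.lintegral_eq_one (h : IsLimitMass η Ξ) (hη : ∀ᵐ a ∂η, ∑' d, a d = 1) (j : ℤ) :
    ∫⁻ r, ENNReal.ofReal (Ξ r j) ∂envLaw η = 1 := by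
  obtain ⟨e, he, hle⟩ := h.exists_absDist_rate
  have hm := h.measurable_ofReal j
  have h1 : Tendsto (fun n => 1 + e n) atTop (𝓝 1) := by
    simpa using tendsto_const_nhds.add he
  have h2 : Tendsto (fun n => ∫⁻ r, ENNReal.ofReal (Ξ r j) ∂envLaw η + e n) atTop
      (𝓝 (∫⁻ r, ENNReal.ofReal (Ξ r j) ∂envLaw η)) := by
    simpa using tendsto_const_nhds.add he
  refine le_antisymm (ge_of_tendsto' h1 fun n => ?_) (ge_of_tendsto' h2 fun n => ?_)
  · calc ∫⁻ r, ENNReal.ofReal (Ξ r j) ∂envLaw η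
        ≤ ∫⁻ r, (mass n r j + absDist (mass n r j) (ENNReal.ofReal (Ξ r j))) ∂envLaw η :=
          lintegral_mono fun r => by rw [absDist_comm]; exact le_add_absDist _ _
      _ ≤ 1 + e n := by
        rw [lintegral_add_left (by fun_prop), lintegral_mass hη]
        gcongr; exact hle n j
  · calc (1 : ℝ≥0∞) = ∫⁻ r, mass n r j ∂envLaw η := (lintegral_mass hη n j).symm
      _ ≤ ∫⁻ r, (ENNReal.ofReal (Ξ r j) +
            absDist (mass n r j) (ENNReal.ofReal (Ξ r j))) ∂envLaw η :=
          lintegral_mono fun r => le_add_absDist _ _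
      _ ≤ _ := by
        rw [lintegral_add_left hm]
        gcongr; exact hle n j

/-- The limit mass of a sequence of exchange matrices is obtained by applying the first matrix to
the limit mass of the others. -/
lemma IsLimitMass.push_eq (h : IsLimitMass η Ξ) (hη : ∀ᵐ a ∂η, ∑' d, a d = 1) :
    ∀ᵐ q ∂(exchangeLaw η).prod (envLaw η), ∀ j,
      push (fun i => ENNReal.ofReal (Ξ q.2 i)) q.1 j =
        ENNReal.ofReal (Ξ (consMat q.1 q.2) j) := by
  rw [ae_all_iff]
  intro j
  obtain ⟨e, he, hle⟩ := h.exists_absDist_rate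
  have hm (i : ℤ) : Measurable fun q : EMat × (ℕ → EMat) => ENNReal.ofReal (Ξ q.2 i) :=
    (h.measurable_ofReal i).comp measurable_snd
  have hmc : Measurable fun q : EMat × (ℕ → EMat) => ENNReal.ofReal (Ξ (consMat q.1 q.2) j) :=
    (h.measurable_ofReal j).comp (by fun_prop)
  have hmass (n : ℕ) (q : EMat × (ℕ → EMat)) :
      mass (n + 1) (consMat q.1 q.2) j = push (mass n q.2) q.1 j := by
    rw [mass_succ]; rfl
  have hpm : Measurable fun q : EMat × (ℕ → EMat) =>
      push (fun i => ENNReal.ofReal (Ξ q.2 i)) q.1 j :=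
    Measurable.tsum fun i => (hm i).mul (by fun_prop)
  have hbound (n : ℕ) : ∫⁻ q, absDist (push (fun i => ENNReal.ofReal (Ξ q.2 i)) q.1 j)
      (ENNReal.ofReal (Ξ (consMat q.1 q.2) j)) ∂(exchangeLaw η).prod (envLaw η) ≤
        e n + e (n + 1) := by
    calc _ ≤ ∫⁻ q, ((∑' i, absDist (mass n q.2 i) (ENNReal.ofReal (Ξ q.2 i)) * q.1 i j) +
            absDist (mass (n + 1) (consMat q.1 q.2) j)
              (ENNReal.ofReal (Ξ (consMat q.1 q.2) j))) ∂(exchangeLaw η).prod (envLaw η) := by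
          refine lintegral_mono fun q => ?_
          refine (absDist_triangle _ (mass (n + 1) (consMat q.1 q.2) j) _).trans ?_
          gcongr
          rw [absDist_comm, hmass]
          exact absDist_push_le _ _ _ _
      _ = ∑' i, (∫⁻ r, absDist (mass n r i) (ENNReal.ofReal (Ξ r i)) ∂envLaw η) *
              meanRow η (j - i) +
            ∫⁻ r, absDist (mass (n + 1) r j) (ENNReal.ofReal (Ξ r j)) ∂envLaw η := by
          have h1 (i : ℤ) : Measurable fun q : EMat × (ℕ → EMat) =>
              absDist (mass n q.2 i) (ENNReal.ofReal (Ξ q.2 i)) :=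
            measurable_absDist (by fun_prop) (hm i)
          have h3 : Measurable fun r => absDist (mass (n + 1) r j) (ENNReal.ofReal (Ξ r j)) :=
            measurable_absDist (by fun_prop) (h.measurable_ofReal j)
          have h2 (i : ℤ) : Measurable fun q : EMat × (ℕ → EMat) =>
              absDist (mass n q.2 i) (ENNReal.ofReal (Ξ q.2 i)) * q.1 i j :=
            (h1 i).mul (by fun_prop)
          rw [lintegral_add_left (Measurable.tsum h2)]
          congr 1
          · rw [lintegral_tsum fun i => (h2 i).aemeasurable]
            refine tsum_congr fun i => ?_
            rw [← lintegral_exchangeLaw_entry, mul_comm, ← lintegral_prod_mul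
              (f := fun A : EMat => A i j) (Measurable.aemeasurable (by fun_prop))
              (measurable_absDist (by fun_prop) (h.measurable_ofReal i)).aemeasurable]
            exact lintegral_congr fun q => mul_comm _ _
          · conv_rhs => rw [← map_consMat, lintegral_map h3 (by fun_prop)]
      _ ≤ ∑' i, e n * meanRow η (j - i) + e (n + 1) := by
          gcongr with i
          · exact hle n i
          · exact hle (n + 1) j
      _ = e n + e (n + 1) := by
          rw [ENNReal.tsum_mul_left, tsum_sub_left (meanRow η), tsum_meanRow hη, mul_one]
  have hlim : Tendsto (fun n => e n + e (n + 1)) atTop (𝓝 0) := by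
    simpa using he.add (he.comp (tendsto_add_atTop_nat 1))
  have hzero := le_antisymm (ge_of_tendsto' hlim hbound) zero_le
  rw [lintegral_eq_zero_iff (measurable_absDist hpm hmc)] at hzero
  filter_upwards [hzero] with q hq
  exact eq_of_absDist_eq_zero hq

end

section

/-! ### From real matrices to matrices with entries in `[0, ∞]` -/

/-- The entries of a real matrix, as elements of `[0, ∞]`. -/
noncomputable def toEMat (A : Mat) : EMat := fun i j => ENNReal.ofReal (A i j)

/-- The law of a row with entries in `[0, ∞]`. -/
noncomputable def rowLaw (ρ : ProbabilityMeasure (ℤ → ℝ)) : Measure (ℤ → ℝ≥0∞) :=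
  (ρ : Measure (ℤ → ℝ)).map fun p d => ENNReal.ofReal (p d)

/-- The matrix has non-negative entries and row sums one. -/
def IsStochastic (A : Mat) : Prop := (∀ i j, 0 ≤ A i j) ∧ ∀ i, ∑' j, toEMat A i j = 1

lemma measurable_ofReal_pi : Measurable fun (x : ℤ → ℝ) d => ENNReal.ofReal (x d) := by fun_prop

@[fun_prop]
lemma measurable_toEMat : Measurable toEMat := by unfold toEMat; fun_prop

instance (ρ : ProbabilityMeasure (ℤ → ℝ)) : IsProbabilityMeasure (rowLaw ρ) :=
  Measure.isProbabilityMeasure_map measurable_ofReal_pi.aemeasurable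

lemma tsum_ofReal_eq_one {p : ℤ → ℝ} (h0 : ∀ j, 0 ≤ p j) (h1 : HasSum p 1) :
    ∑' d, ENNReal.ofReal (p d) = 1 := by
  rw [← ENNReal.ofReal_tsum_of_nonneg h0 h1.summable, h1.tsum_eq, ENNReal.ofReal_one]

lemma ae_rowLaw_tsum {ρ : ProbabilityMeasure (ℤ → ℝ)} (hρ : IsSharingLaw ρ) :
    ∀ᵐ a ∂rowLaw ρ, ∑' d, a d = 1 := by
  rw [rowLaw, ae_map_iff measurable_ofReal_pi.aemeasurable
    (measurableSet_eq_fun (by fun_prop) measurable_const)]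
  filter_upwards [hρ] with p hp using tsum_ofReal_eq_one hp.1 hp.2

lemma not_ae_rowLaw_dirac {ρ : ProbabilityMeasure (ℤ → ℝ)} (hnd : ¬ IsAlmostSurelyDirac ρ) :
    ¬ ∀ᵐ a ∂rowLaw ρ, ∃ d, a d = 1 := by
  intro h
  refine hnd ?_
  filter_upwards [ae_of_ae_map measurable_ofReal_pi.aemeasurable h] with p hp
  obtain ⟨d, hd⟩ := hp
  exact ⟨d, ENNReal.ofReal_eq_one.1 hd⟩

lemma summable_of_tsum_ofReal {ι : Type*} {f : ι → ℝ} (hf : ∀ i, 0 ≤ f i)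
    (h : ∑' i, ENNReal.ofReal (f i) ≠ ∞) : Summable f := by
  have := ENNReal.summable_toReal h
  simpa [ENNReal.toReal_ofReal, hf] using this

lemma IsStochastic.one : IsStochastic matOne := by
  refine ⟨fun i j => ?_, fun i => ?_⟩
  · unfold matOne; split_ifs <;> norm_num
  · rw [tsum_eq_single i]
    · simp [toEMat, matOne]
    · intro j hj
      simp [toEMat, matOne, hj.symm]

lemma toEMat_matMul {A B : Mat} (hA : IsStochastic A) (hB : IsStochastic B) :
    toEMat (matMul A B) = emul (toEMat A) (toEMat B) := by
  funext i j
  have hle (k : ℤ) : toEMat B k j ≤ 1 := (ENNReal.le_tsum j).trans (hB.2 k).le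
  have hnn (k : ℤ) : 0 ≤ A i k * B k j := mul_nonneg (hA.1 i k) (hB.1 k j)
  have heq (k : ℤ) : ENNReal.ofReal (A i k * B k j) = toEMat A i k * toEMat B k j :=
    ENNReal.ofReal_mul (hA.1 i k)
  have hfin : ∑' k, ENNReal.ofReal (A i k * B k j) ≠ ∞ := by
    refine ne_top_of_le_ne_top ENNReal.one_ne_top ((ENNReal.tsum_le_tsum fun k => ?_).trans
      (hA.2 i).le)
    rw [heq]
    exact mul_le_of_le_one_right zero_le (hle k)
  rw [toEMat, matMul, ENNReal.ofReal_tsum_of_nonneg hnn (summable_of_tsum_ofReal hnn hfin)]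
  simp_rw [heq]
  rfl

lemma IsStochastic.mul {A B : Mat} (hA : IsStochastic A) (hB : IsStochastic B) :
    IsStochastic (matMul A B) := by
  refine ⟨fun i j => tsum_nonneg fun k => mul_nonneg (hA.1 i k) (hB.1 k j), fun i => ?_⟩
  rw [toEMat_matMul hA hB]
  simp_rw [emul, push]
  rw [ENNReal.tsum_comm]
  simp_rw [ENNReal.tsum_mul_left, hB.2, mul_one, hA.2]

lemma IsStochastic.matProd {M : ℕ → Mat} (hM : ∀ n, IsStochastic (M n)) (n : ℕ) :
    IsStochastic (matProd M n) := by
  induction n with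
  | zero => exact .one
  | succ n ih => exact ih.mul (hM n)

lemma toEMat_matProd {M : ℕ → Mat} (hM : ∀ n, IsStochastic (M n)) (n : ℕ) :
    toEMat (matProd M n) = backProd n fun k => toEMat (M (n - 1 - k)) := by
  induction n with
  | zero =>
    funext i j
    simp only [toEMat, MassExchange.matProd, matOne, backProd]
    split_ifs <;> simp
  | succ n ih =>
    rw [MassExchange.matProd, toEMat_matMul (IsStochastic.matProd hM n) (hM n), ih, backProd]
    congr 1
    refine backProd_congr fun k _ => ?_
    congr 2
    omega

/-- If the corresponding sums in `[0, ∞]` are finite, then a row vector and a stochastic matrix can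
be multiplied. -/
lemma summable_mul_and_vecMul {x : Config} (hx : ∀ i, 0 ≤ x i) {A : Mat} (hA : IsStochastic A)
    (hfin : ∀ j, push (fun i => ENNReal.ofReal (x i)) (toEMat A) j ≠ ∞) :
    (∀ j, Summable fun i => x i * A i j) ∧
      vecMul x A = fun j => (push (fun i => ENNReal.ofReal (x i)) (toEMat A) j).toReal := by
  have heq (i j : ℤ) : ENNReal.ofReal (x i * A i j) = ENNReal.ofReal (x i) * toEMat A i j :=
    ENNReal.ofReal_mul (hx i)
  have hnn (i j : ℤ) : 0 ≤ x i * A i j := mul_nonneg (hx i) (hA.1 i j)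
  have hs (j : ℤ) : Summable fun i => x i * A i j := by
    refine summable_of_tsum_ofReal (fun i => hnn i j) ?_
    simp_rw [heq]
    exact hfin j
  refine ⟨hs, funext fun j => ?_⟩
  have h := ENNReal.ofReal_tsum_of_nonneg (fun i => hnn i j) (hs j)
  simp_rw [heq] at h
  rw [push, ← h, vecMul, ENNReal.toReal_ofReal (tsum_nonneg fun i => hnn i j)]

variable {Ω : Type*} [MeasurableSpace Ω] {P : Measure Ω} {ρ : ProbabilityMeasure (ℤ → ℝ)}
  {M : ℕ → Ω → Mat}

lemma IsExchange.measurable_entry (hM : IsExchange ρ P M) (n : ℕ) (i j : ℤ) :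
    Measurable fun ω => M n ω i j := by
  have := (measurable_pi_apply (j - i)).comp (hM.measurable_row n i)
  simpa [Function.comp_def] using this

lemma IsExchange.measurable_mat (hM : IsExchange ρ P M) (n : ℕ) : Measurable (M n) :=
  measurable_pi_lambda _ fun i => measurable_pi_lambda _ fun j => hM.measurable_entry n i j

lemma IsExchange.ae_isStochastic (hM : IsExchange ρ P M) (hρ : IsSharingLaw ρ) :
    ∀ᵐ ω ∂P, ∀ n, IsStochastic (M n ω) := by
  have h : ∀ᵐ ω ∂P, ∀ n i, (∀ j, 0 ≤ M n ω i (i + j)) ∧ HasSum (fun j => M n ω i (i + j)) 1 := by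
    rw [ae_all_iff]; intro n
    rw [ae_all_iff]; intro i
    refine ae_of_ae_map (hM.measurable_row n i).aemeasurable
      (p := fun p : ℤ → ℝ => (∀ j, 0 ≤ p j) ∧ HasSum p 1) ?_
    rw [hM.law_row]
    exact hρ
  filter_upwards [h] with ω hω n
  refine ⟨fun i j => by simpa using (hω n i).1 (j - i), fun i => ?_⟩
  rw [← tsum_ofReal_eq_one (hω n i).1 (hω n i).2, ← (Equiv.addLeft i).tsum_eq]
  rfl

lemma IsExchange.map_eq_envLaw [IsProbabilityMeasure P] (hM : IsExchange ρ P M) :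
    P.map (fun ω n => toEMat (M n ω)) = envLaw (rowLaw ρ) := by
  let X : ℕ × ℤ → Ω → ℤ → ℝ≥0∞ := fun q ω d => ENNReal.ofReal (M q.1 ω q.2 (q.2 + d))
  have hX (q) : Measurable (X q) := measurable_ofReal_pi.comp (hM.measurable_row q.1 q.2)
  have hXi : iIndepFun X P := hM.indep_rows.comp (fun _ x d => ENNReal.ofReal (x d))
    fun _ => measurable_ofReal_pi
  have hlaw : P.map (fun ω q => X q ω) = Measure.infinitePi fun _ : ℕ × ℤ => rowLaw ρ := by
    rw [hXi.map_fun_eq_infinitePi_map hX]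
    congr 1
    funext q
    rw [rowLaw, ← hM.law_row q.1 q.2, Measure.map_map measurable_ofReal_pi
      (hM.measurable_row q.1 q.2)]
    rfl
  have hcurry := Measure.infinitePi_map_curry fun (_ : ℕ) (_ : ℤ) => rowLaw ρ
  have hpi := Measure.infinitePi_map_pi (fun _ : ℕ => Measure.infinitePi fun _ : ℤ => rowLaw ρ)
    (f := fun _ (a : ℤ → ℤ → ℝ≥0∞) (i j : ℤ) => a i (j - i)) fun _ => measurable_uncenter
  rw [envLaw]
  simp_rw [exchangeLaw]
  rw [← hpi, ← hcurry, ← hlaw, Measure.map_map (by fun_prop) (by fun_prop),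
    Measure.map_map (by fun_prop) (by fun_prop)]
  congr 1
  funext ω n i j
  simp [X, toEMat, MeasurableEquiv.curry]

/-! ### Time reversal -/

/-- The permutation of the times that reverses the order of the first `n`. -/
def revTime (n k : ℕ) : ℕ := if k < n then n - 1 - k else k

lemma revTime_injective (n : ℕ) : Function.Injective (revTime n) := by
  intro a b h
  unfold revTime at h
  split_ifs at h <;> omega

lemma map_revTime (η : Measure (ℤ → ℝ≥0∞)) [IsProbabilityMeasure η] (n : ℕ) :
    (envLaw η).map (fun r k => r (revTime n k)) = envLaw η :=
  Measure.map_infinitePi_infinitePi_of_inj (revTime_injective n)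

lemma toEMat_matProd_eq_revTime {M : ℕ → Mat} (hM : ∀ n, IsStochastic (M n)) (n : ℕ) :
    toEMat (matProd M n) = backProd n fun k => toEMat (M (revTime n k)) := by
  rw [toEMat_matProd hM]
  exact backProd_congr fun k hk => by rw [revTime, if_pos hk]

end

section

/-! ### Convergence in distribution -/

lemma edist_toReal_sq_le (a : ℝ≥0∞) {y : ℝ} (hy : 0 ≤ y) :
    edist a.toReal y ^ 2 ≤ sqDist a (ENNReal.ofReal y) := by
  by_cases ha : a = ∞
  · simp [ha, sqDist]
  · rw [edist_eq_enorm_sub, enorm_sub_sq ENNReal.toReal_nonneg hy, ENNReal.ofReal_toReal ha]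

lemma tendstoInDistribution_of_lintegral_sqDist {Ω : Type*} [MeasurableSpace Ω] {Q : Measure Ω}
    [IsProbabilityMeasure Q] {Y : ℕ → Ω → ℤ → ℝ≥0∞} (hY : ∀ n j, Measurable fun ω => Y n ω j)
    {G : Ω → ℤ → ℝ} (hG : ∀ j, Measurable fun ω => G ω j) (hG0 : ∀ ω j, 0 ≤ G ω j)
    (hlim : ∀ j, Tendsto (fun n => ∫⁻ ω, sqDist (Y n ω j) (ENNReal.ofReal (G ω j)) ∂Q) atTop (𝓝 0))
    (J : Finset ℤ) :
    TendstoInDistribution (fun n ω (j : J) => (Y n ω j).toReal) atTop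
      (fun ω (j : J) => G ω j) (fun _ => Q) Q := by
  refine TendstoInMeasure.tendstoInDistribution ?_ fun n =>
    (measurable_pi_lambda _ fun j : J => (hY n j).ennreal_toReal).aemeasurable
  refine tendstoInMeasure_of_ne_top fun ε hε hε' => ?_
  have hd (n : ℕ) (j : ℤ) : Measurable fun ω => sqDist (Y n ω j) (ENNReal.ofReal (G ω j)) :=
    measurable_sqDist (hY n j) (hG j).ennreal_ofReal
  have hle (n : ℕ) : Q {ω | ε ≤ edist (fun j : J => (Y n ω j).toReal) fun j : J => G ω j} ≤
      (∑ j : J, ∫⁻ ω, sqDist (Y n ω j) (ENNReal.ofReal (G ω j)) ∂Q) / ε ^ 2 := by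
    rw [← lintegral_finsetSum _ fun (j : J) _ => hd n j]
    refine (measure_mono fun ω hω => ?_).trans (meas_ge_le_lintegral_div
      (Finset.measurable_sum _ fun (j : J) _ => hd n j).aemeasurable (pow_ne_zero 2 hε.ne')
        (ENNReal.pow_ne_top hε'))
    rw [Set.mem_ofPred_eq] at hω ⊢
    rw [edist_pi_def] at hω
    obtain ⟨j, -, hj⟩ := (Finset.le_sup_iff hε).1 hω
    calc ε ^ 2 ≤ edist (Y n ω j).toReal (G ω j) ^ 2 := by gcongr
      _ ≤ sqDist (Y n ω j) (ENNReal.ofReal (G ω j)) := edist_toReal_sq_le _ (hG0 ω j)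
      _ ≤ _ := Finset.single_le_sum (f := fun j : J => sqDist (Y n ω j)
          (ENNReal.ofReal (G ω j))) (fun _ _ => zero_le) (Finset.mem_univ j)
  refine tendsto_of_tendsto_of_tendsto_of_le_of_le tendsto_const_nhds ?_ (fun _ => zero_le) hle
  have h1 : Tendsto (fun n => ∑ j : J, ∫⁻ ω, sqDist (Y n ω j) (ENNReal.ofReal (G ω j)) ∂Q) atTop
      (𝓝 0) := by
    simpa using tendsto_finsetSum (Finset.univ : Finset J) fun j _ => hlim j
  simpa using ENNReal.Tendsto.div_const h1 (Or.inr (pow_ne_zero 2 hε.ne'))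

/-- Convergence in distribution depends only on the laws. -/
lemma tendstoInDistribution_of_map_eq {Ω₁ Ω₂ Ω₃ Ω₄ E : Type*} [MeasurableSpace Ω₁]
    [MeasurableSpace Ω₂] [MeasurableSpace Ω₃] [MeasurableSpace Ω₄] [TopologicalSpace E]
    [MeasurableSpace E] [OpensMeasurableSpace E] {P₁ : Measure Ω₁} {P₂ : Measure Ω₂}
    {P₃ : Measure Ω₃} {P₄ : Measure Ω₄} [IsProbabilityMeasure P₁] [IsProbabilityMeasure P₂]
    [IsProbabilityMeasure P₃] [IsProbabilityMeasure P₄] {X : ℕ → Ω₁ → E} {Z : Ω₂ → E}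
    {X' : ℕ → Ω₃ → E} {Z' : Ω₄ → E}
    (h : TendstoInDistribution X atTop Z (fun _ => P₁) P₂) (hX' : ∀ n, AEMeasurable (X' n) P₃)
    (hZ' : AEMeasurable Z' P₄) (hX : ∀ n, P₃.map (X' n) = P₁.map (X n))
    (hZ : P₄.map Z' = P₂.map Z) : TendstoInDistribution X' atTop Z' (fun _ => P₃) P₄ := by
  refine ⟨hX', hZ', ?_⟩
  simp_rw [hX, hZ]
  exact h.tendsto

lemma WeakConv.map_eq {Ω₁ Ω₂ Ω₃ : Type*} [MeasurableSpace Ω₁] [MeasurableSpace Ω₂]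
    [MeasurableSpace Ω₃] {P₁ : Measure Ω₁} {P₂ : Measure Ω₂} {P₃ : Measure Ω₃}
    [IsProbabilityMeasure P₁] [IsProbabilityMeasure P₂] [IsProbabilityMeasure P₃]
    {X : ℕ → Ω₁ → Config} {Y : Ω₂ → Config} {Z : Ω₃ → Config} (hY : Measurable Y)
    (hZ : Measurable Z) (h : WeakConv P₁ P₂ X Y) (h' : WeakConv P₁ P₃ X Z) :
    P₂.map Y = P₃.map Z := by
  have := Measure.isProbabilityMeasure_map (μ := P₃) hZ.aemeasurable
  have hlim : IsProjectiveLimit (P₂.map Y)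
      (fun J : Finset ℤ => (P₃.map Z).map J.restrict) := by
    intro J
    have h1 := tendstoInDistribution_unique _ (h J) (h' J)
    change _ = (P₃.map Z).map J.restrict
    rw [Measure.map_map (by fun_prop) hY, Measure.map_map (by fun_prop) hZ]
    exact h1
  have (J : Finset ℤ) : IsProbabilityMeasure ((P₃.map Z).map J.restrict) :=
    Measure.isProbabilityMeasure_map (by fun_prop)
  exact hlim.unique fun J => rfl

/-! ### Independent initial masses -/

/-- A weighted sum of pairwise independent variables with common mean `c` is, in mean square, close
to `c` times the sum of the weights, if the squared weights have a small sum. -/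
lemma lintegral_sqDist_tsum_le {Ω : Type*} [MeasurableSpace Ω] {P : Measure Ω}
    {Z : ℤ → Ω → ℝ≥0∞} (hZ : ∀ i, Measurable (Z i)) [IsProbabilityMeasure P]
    (hi : Pairwise fun i j => IndepFun (Z i) (Z j) P) {c q : ℝ≥0∞} (hc : c ≠ ∞)
    (hZ1 : ∀ i, ∫⁻ ω, Z i ω ∂P = c) (hZ2 : ∀ i, ∫⁻ ω, Z i ω ^ 2 ∂P = q) {x : ℤ → ℝ≥0∞}
    (hx : ∑' i, x i ≠ ∞) :
    ∫⁻ ω, sqDist (∑' i, Z i ω * x i) (c * ∑' i, x i) ∂P ≤ q * ∑' i, x i ^ 2 := by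
  simp_rw [mul_comm (Z _ _)]
  have hm : Measurable fun ω => ∑' i, x i * Z i ω := by fun_prop
  have hvar := lintegral_sq_tsum_of_indep hZ hi x
  simp_rw [hZ1, hZ2, ENNReal.tsum_mul_right] at hvar
  set S := ∑' i, x i
  have hle : ∫⁻ ω, (∑' i, x i * Z i ω) ^ 2 ∂P ≤ (S * c) ^ 2 + (∑' i, x i ^ 2) * q :=
    le_self_add.trans hvar.le
  have hmean : ∫⁻ ω, ∑' i, x i * Z i ω ∂P = S * c := by
    rw [lintegral_tsum fun i => by fun_prop]
    simp_rw [lintegral_const_mul _ (hZ _), hZ1, ENNReal.tsum_mul_right]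
    rfl
  have hpol : ∫⁻ ω, ((∑' i, x i * Z i ω) ^ 2 + (c * S) ^ 2) ∂P =
      ∫⁻ ω, (2 * ((∑' i, x i * Z i ω) * (c * S)) +
        sqDist (∑' i, x i * Z i ω) (c * S)) ∂P := lintegral_congr fun ω => sq_add_sq_eq _ _
  rw [lintegral_add_left (by fun_prop), lintegral_add_left (by fun_prop),
    lintegral_const_mul _ (by fun_prop), lintegral_mul_const _ hm, hmean, lintegral_const,
    measure_univ, mul_one] at hpol
  have hfin : 2 * (S * c * (c * S)) ≠ ∞ := by finiteness
  refine (ENNReal.add_le_add_iff_left hfin).1 ?_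
  rw [← hpol]
  calc _ ≤ (S * c) ^ 2 + (∑' i, x i ^ 2) * q + (c * S) ^ 2 := by gcongr
    _ = _ := by ring

variable {Ω : Type*} [MeasurableSpace Ω] {P : Measure Ω} {ρ : ProbabilityMeasure (ℤ → ℝ)}
  {M : ℕ → Ω → Mat} {τ : Ω → Config} {m : ℝ}

lemma IsInitial.measurable (hτ : IsInitial P τ m) : Measurable τ :=
  measurable_pi_lambda _ hτ.measurable_coord

lemma IsInitial.measurable_ofReal (hτ : IsInitial P τ m) (i : ℤ) :
    Measurable fun ω => ENNReal.ofReal (τ ω i) := (hτ.measurable_coord i).ennreal_ofReal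

lemma IsInitial.lintegral_eq [IsFiniteMeasure P] (hτ : IsInitial P τ m) (i : ℤ) :
    ∫⁻ ω, ENNReal.ofReal (τ ω i) ∂P = ENNReal.ofReal m := by
  rw [← ofReal_integral_eq_lintegral_ofReal
    ((hτ.memLp_two i).integrable (by norm_num)) (hτ.nonneg i), hτ.mean_eq]

lemma IsInitial.lintegral_sq_eq (hτ : IsInitial P τ m) (i : ℤ) :
    ∫⁻ ω, ENNReal.ofReal (τ ω i) ^ 2 ∂P = ∫⁻ ω, ENNReal.ofReal (τ ω 0) ^ 2 ∂P :=
  ((hτ.ident i 0).comp (u := fun x => ENNReal.ofReal x ^ 2) (by fun_prop)).lintegral_eq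

lemma IsInitial.lintegral_sq_ne_top (hτ : IsInitial P τ m) :
    ∫⁻ ω, ENNReal.ofReal (τ ω 0) ^ 2 ∂P ≠ ∞ := by
  have h := (hτ.memLp_two 0).eLpNorm_lt_top
  rw [eLpNorm_two_eq] at h
  have h2 : ∫⁻ ω, ‖τ ω 0‖ₑ ^ 2 ∂P ≠ ∞ := by
    intro h3
    simp [h3] at h
  refine ne_top_of_le_ne_top h2 (lintegral_mono fun ω => ?_)
  gcongr
  exact Real.ofReal_le_enorm _

lemma IsInitial.pairwise_indep (hτ : IsInitial P τ m) : Pairwise fun i j =>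
    IndepFun (fun ω => ENNReal.ofReal (τ ω i)) (fun ω => ENNReal.ofReal (τ ω j)) P :=
  fun _ _ hij => (hτ.indep.indepFun hij).comp ENNReal.measurable_ofReal ENNReal.measurable_ofReal

lemma IsInitial.mean_nonneg (hτ : IsInitial P τ m) : 0 ≤ m := by
  rw [← hτ.mean_eq 0]
  exact integral_nonneg_of_ae (hτ.nonneg 0)

/-- The mass at `j` after `n` exchanges, in reversed order, of an initial configuration that is
defined on another probability space. -/
noncomputable def initialMass (τ : Ω → Config) (n : ℕ) (q : Ω × (ℕ → EMat)) (j : ℤ) : ℝ≥0∞ :=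
  push (fun i => ENNReal.ofReal (τ q.1 i)) (backProd n q.2) j

lemma IsInitial.measurable_initialMass (hτ : IsInitial P τ m) (n : ℕ) (j : ℤ) :
    Measurable fun q => initialMass τ n q j := by
  have h (i : ℤ) : Measurable fun q : Ω × (ℕ → EMat) => ENNReal.ofReal (τ q.1 i) :=
    (hτ.measurable_ofReal i).comp measurable_fst
  exact Measurable.tsum fun i => (h i).mul (by fun_prop)

variable {η : Measure (ℤ → ℝ≥0∞)} [IsProbabilityMeasure η] {Ξ : (ℕ → EMat) → ℤ → ℝ}

lemma IsInitial.lintegral_initialMass [IsProbabilityMeasure P] (hτ : IsInitial P τ m)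
    (hη : ∀ᵐ a ∂η, ∑' d, a d = 1) (n : ℕ) (j : ℤ) :
    ∫⁻ q, initialMass τ n q j ∂P.prod (envLaw η) = ENNReal.ofReal m := by
  have hb (i : ℤ) : Measurable fun r : ℕ → EMat => backProd n r i j := by fun_prop
  have h (i : ℤ) : Measurable fun q : Ω × (ℕ → EMat) =>
      ENNReal.ofReal (τ q.1 i) * backProd n q.2 i j :=
    ((hτ.measurable_ofReal i).comp measurable_fst).mul ((hb i).comp measurable_snd)
  simp_rw [initialMass, push]
  rw [lintegral_tsum fun i => (h i).aemeasurable]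
  simp_rw [lintegral_prod_mul (hτ.measurable_ofReal _).aemeasurable (hb _).aemeasurable,
    hτ.lintegral_eq]
  rw [ENNReal.tsum_mul_left, ← lintegral_tsum fun i => (hb i).aemeasurable]
  have := lintegral_mass hη n j
  simp_rw [mass] at this
  rw [this, mul_one]

lemma IsInitial.tendsto_lintegral_sqDist [IsProbabilityMeasure P] (hτ : IsInitial P τ m)
    (hη : ∀ᵐ a ∂η, ∑' d, a d = 1) (hnd : ¬ ∀ᵐ a ∂η, ∃ d, a d = 1) (hΞ : IsLimitMass η Ξ) (j : ℤ) :
    Tendsto (fun n => ∫⁻ q, sqDist (initialMass τ n q j) (ENNReal.ofReal (m * Ξ q.2 j))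
      ∂P.prod (envLaw η)) atTop (𝓝 0) := by
  set c := ENNReal.ofReal m
  have hc : c ≠ ∞ := ENNReal.ofReal_ne_top
  set s := ∫⁻ ω, ENNReal.ofReal (τ ω 0) ^ 2 ∂P
  have hY (n : ℕ) := hτ.measurable_initialMass n j
  -- averaging over the initial masses replaces them by their mean
  have h1 (n : ℕ) : ∫⁻ q, sqDist (initialMass τ n q j) (c * mass n q.2 j) ∂P.prod (envLaw η) ≤
      s * ∑' i, ∫⁻ r, backProd n r i j ^ 2 ∂envLaw η := by
    have hb (i : ℤ) : Measurable fun r : ℕ → EMat => backProd n r i j ^ 2 := by fun_prop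
    rw [lintegral_prod_symm _ (measurable_sqDist (hY n) (by fun_prop)).aemeasurable,
      ← lintegral_tsum fun i => (hb i).aemeasurable, ← lintegral_const_mul _ (Measurable.tsum hb)]
    refine lintegral_mono_ae ?_
    have hfin : ∀ᵐ r ∂envLaw η, mass n r j < ∞ :=
      ae_lt_top (by fun_prop) (by rw [lintegral_mass hη]; simp)
    filter_upwards [hfin] with r hr
    exact lintegral_sqDist_tsum_le hτ.measurable_ofReal hτ.pairwise_indep hc hτ.lintegral_eq
      hτ.lintegral_sq_eq hr.ne
  obtain ⟨e, he, hle⟩ := hΞ.exists_rate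
  have h2 (n : ℕ) : ∫⁻ q, sqDist (c * mass n q.2 j) (ENNReal.ofReal (m * Ξ q.2 j))
      ∂P.prod (envLaw η) ≤ c ^ 2 * e n := by
    simp_rw [ENNReal.ofReal_mul hτ.mean_nonneg]
    have hm : Measurable fun r => sqDist (mass n r j) (ENNReal.ofReal (Ξ r j)) :=
      measurable_sqDist (by fun_prop) (hΞ.measurable_ofReal j)
    calc _ = ∫⁻ q, 1 * (c ^ 2 * sqDist (mass n q.2 j) (ENNReal.ofReal (Ξ q.2 j)))
            ∂P.prod (envLaw η) := lintegral_congr fun q => by rw [one_mul, sqDist_mul _ _ _ hc]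
      _ = c ^ 2 * ∫⁻ r, sqDist (mass n r j) (ENNReal.ofReal (Ξ r j)) ∂envLaw η := by
          rw [lintegral_prod_mul (f := fun _ => 1) aemeasurable_const
            (hm.const_mul _).aemeasurable, lintegral_const_mul _ hm]
          simp
      _ ≤ _ := by gcongr; exact hle n j
  have h3 (n : ℕ) : ∫⁻ q, sqDist (initialMass τ n q j) (ENNReal.ofReal (m * Ξ q.2 j))
      ∂P.prod (envLaw η) ≤
        2 * (s * ∑' i, ∫⁻ r, backProd n r i j ^ 2 ∂envLaw η) + 2 * (c ^ 2 * e n) := by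
    have hmΞ : Measurable fun q : Ω × (ℕ → EMat) => ENNReal.ofReal (m * Ξ q.2 j) :=
      (((measurable_pi_apply j).comp hΞ.measurable).comp measurable_snd).const_mul m
        |>.ennreal_ofReal
    refine (lintegral_sqDist_triangle (hY n) (g := fun q => c * mass n q.2 j) (by fun_prop)
      hmΞ).trans ?_
    gcongr
    · exact h1 n
    · exact h2 n
  refine tendsto_of_tendsto_of_tendsto_of_le_of_le tendsto_const_nhds ?_ (fun _ => zero_le) h3
  have h4 := ENNReal.Tendsto.const_mul (a := 2) (ENNReal.Tendsto.const_mul (a := s)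
    (tendsto_sum_sq_backProd hη hnd j) (Or.inr hτ.lintegral_sq_ne_top)) (Or.inr (by simp))
  have h5 := ENNReal.Tendsto.const_mul (a := 2) (ENNReal.Tendsto.const_mul (a := c ^ 2) he
    (Or.inr (ENNReal.pow_ne_top hc))) (Or.inr (by simp))
  simpa using h4.add h5

/-- The law of a configuration and of the environment, if these are independent. -/
lemma map_prodMk_env [IsProbabilityMeasure P] (hM : IsExchange ρ P M) (hτ : Measurable τ)
    (h : IndepFun τ (fun ω n => M n ω) P) (n : ℕ) :
    P.map (fun ω => ((fun i => ENNReal.ofReal (τ ω i) : ℤ → ℝ≥0∞),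
        fun k => toEMat (M (revTime n k) ω))) =
      (P.prod (envLaw (rowLaw ρ))).map
        fun q => ((fun i => ENNReal.ofReal (τ q.1 i) : ℤ → ℝ≥0∞), q.2) := by
  have hR : Measurable fun ω n => toEMat (M n ω) :=
    measurable_pi_lambda _ fun n => measurable_toEMat.comp (hM.measurable_mat n)
  have hrev : Measurable fun (r : ℕ → EMat) k => r (revTime n k) := by fun_prop
  have hT : Measurable fun ω i => ENNReal.ofReal (τ ω i) := measurable_ofReal_pi.comp hτ
  have hind : IndepFun (fun ω i => ENNReal.ofReal (τ ω i))
      (fun ω k => toEMat (M (revTime n k) ω)) P :=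
    h.comp (φ := fun (x : Config) i => ENNReal.ofReal (x i))
      (ψ := fun (A : ℕ → Mat) k => toEMat (A (revTime n k))) measurable_ofReal_pi
      (measurable_pi_lambda _ fun k => measurable_toEMat.comp (measurable_pi_apply _))
  have hRrev : Measurable fun ω k => toEMat (M (revTime n k) ω) := hrev.comp hR
  rw [(indepFun_iff_map_prod_eq_prod_map_map hT.aemeasurable hRrev.aemeasurable).1 hind]
  have h1 : P.map (fun ω k => toEMat (M (revTime n k) ω)) = envLaw (rowLaw ρ) := by
    rw [← map_revTime (rowLaw ρ) n, ← hM.map_eq_envLaw, Measure.map_map hrev hR]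
    rfl
  rw [h1]
  have h2 := Measure.map_prod_map P (envLaw (rowLaw ρ)) hT measurable_id
  rw [Measure.map_id] at h2
  exact h2

end

section

/-! ### The law of the limit mass -/

variable {ρ : ProbabilityMeasure (ℤ → ℝ)} {Ξ : (ℕ → EMat) → ℤ → ℝ}

/-- The law of the limit mass. -/
noncomputable def limitLaw (ρ : ProbabilityMeasure (ℤ → ℝ)) (hΞ : Measurable Ξ) :
    ProbabilityMeasure Config :=
  ⟨(envLaw (rowLaw ρ)).map Ξ, Measure.isProbabilityMeasure_map hΞ.aemeasurable⟩

lemma coe_limitLaw (hΞ : Measurable Ξ) :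
    (limitLaw ρ hΞ : Measure Config) = (envLaw (rowLaw ρ)).map Ξ := rfl

lemma IsLimitMass.ae_nonneg (h : IsLimitMass (rowLaw ρ) Ξ) :
    ∀ᵐ x ∂(limitLaw ρ h.measurable : Measure Config), ∀ i, 0 ≤ x i := by
  rw [coe_limitLaw, ae_map_iff h.measurable.aemeasurable]
  · exact ae_of_all _ fun r => h.nonneg r
  · simp only [Set.ofPred_forall]
    exact .iInter fun i => measurableSet_le measurable_const (measurable_pi_apply i)

lemma IsLimitMass.integrable_and_integral_eq (h : IsLimitMass (rowLaw ρ) Ξ)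
    (hρ : IsSharingLaw ρ) (j : ℤ) :
    Integrable (fun x : Config => x j) (limitLaw ρ h.measurable : Measure Config) ∧
      ∫ x : Config, x j ∂(limitLaw ρ h.measurable : Measure Config) = 1 := by
  have hj : Measurable fun r => Ξ r j := (measurable_pi_apply j).comp h.measurable
  have h1 := h.lintegral_eq_one (ae_rowLaw_tsum hρ) j
  have hx : AEStronglyMeasurable (fun x : Config => x j)
      (limitLaw ρ h.measurable : Measure Config) := (measurable_pi_apply j).aestronglyMeasurable
  rw [coe_limitLaw] at hx ⊢
  constructor
  · rw [integrable_map_measure hx h.measurable.aemeasurable]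
    refine (lintegral_ofReal_ne_top_iff_integrable hj.aestronglyMeasurable
      (ae_of_all _ fun r => h.nonneg r j)).1 ?_
    rw [h1]
    simp
  · rw [integral_map h.measurable.aemeasurable hx, integral_eq_lintegral_of_nonneg_ae
      (ae_of_all _ fun r => h.nonneg r j) hj.aestronglyMeasurable, h1]
    simp

lemma IsLimitMass.isFixedPoint (h : IsLimitMass (rowLaw ρ) Ξ) (hρ : IsSharingLaw ρ) :
    IsFixedPoint.{u} ρ (limitLaw ρ h.measurable) := by
  refine ⟨h.ae_nonneg, fun Ω _ P _ τ M hM hτ hlaw hind => ?_⟩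
  have hA : Measurable fun ω => toEMat (M 0 ω) := measurable_toEMat.comp (hM.measurable_mat 0)
  have hAlaw : P.map (fun ω => toEMat (M 0 ω)) = exchangeLaw (rowLaw ρ) := by
    have hR : Measurable fun ω n => toEMat (M n ω) :=
      measurable_pi_lambda _ fun n => measurable_toEMat.comp (hM.measurable_mat n)
    have := (measurePreserving_eval_infinitePi (fun _ : ℕ => exchangeLaw (rowLaw ρ)) 0).map_eq
    rw [← this, ← envLaw, ← hM.map_eq_envLaw, Measure.map_map (by fun_prop) hR]
    rfl
  let S : Config × EMat → ℤ → ℝ≥0∞ := fun q => push (fun i => ENNReal.ofReal (q.1 i)) q.2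
  have hS : Measurable S := by
    refine measurable_push ?_ measurable_snd
    exact measurable_ofReal_pi.comp measurable_fst
  have hSr : Measurable fun q j => (S q j).toReal :=
    measurable_pi_lambda _ fun j => ((measurable_pi_apply j).comp hS).ennreal_toReal
  have hcanon : Measurable fun q : EMat × (ℕ → EMat) => ((Ξ q.2, q.1) : Config × EMat) :=
    (h.measurable.comp measurable_snd).prodMk measurable_fst
  have hjoint : P.map (fun ω => (τ ω, toEMat (M 0 ω))) =
      ((exchangeLaw (rowLaw ρ)).prod (envLaw (rowLaw ρ))).map fun q => (Ξ q.2, q.1) := by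
    have hind' : IndepFun τ (fun ω => toEMat (M 0 ω)) P :=
      hind.comp measurable_id measurable_toEMat
    rw [(indepFun_iff_map_prod_eq_prod_map_map hτ.aemeasurable hA.aemeasurable).1 hind', hlaw,
      hAlaw, coe_limitLaw]
    have h2 := Measure.map_prod_map (envLaw (rowLaw ρ)) (exchangeLaw (rowLaw ρ)) h.measurable
      measurable_id
    rw [Measure.map_id] at h2
    rw [h2, ← Measure.prod_swap, Measure.map_map (h.measurable.prodMap measurable_id)
      measurable_swap]
    rfl
  have hpush := h.push_eq (ae_rowLaw_tsum hρ)
  have hfin : ∀ᵐ ω ∂P, ∀ j, S (τ ω, toEMat (M 0 ω)) j ≠ ∞ := by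
    refine ae_of_ae_map (hτ.prodMk hA).aemeasurable (p := fun q => ∀ j, S q j ≠ ∞) ?_
    rw [hjoint, ae_map_iff hcanon.aemeasurable]
    · filter_upwards [hpush] with q hq j
      simp only [S, hq]
      exact ENNReal.ofReal_ne_top
    · simp only [Set.ofPred_forall]
      exact .iInter fun j => (measurableSet_eq_fun ((measurable_pi_apply j).comp hS)
        measurable_const).compl
  have hnn : ∀ᵐ ω ∂P, ∀ i, 0 ≤ τ ω i := by
    refine ae_of_ae_map hτ.aemeasurable (p := fun x : Config => ∀ i, 0 ≤ x i) ?_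
    rw [hlaw]
    exact h.ae_nonneg
  have hvec : (fun ω => vecMul (τ ω) (M 0 ω)) =ᵐ[P] fun ω j =>
      (S (τ ω, toEMat (M 0 ω)) j).toReal := by
    filter_upwards [hfin, hnn, hM.ae_isStochastic hρ] with ω h1 h2 h3
    exact (summable_mul_and_vecMul h2 (h3 0) h1).2
  refine ⟨?_, ?_, ?_⟩
  · filter_upwards [hfin, hnn, hM.ae_isStochastic hρ] with ω h1 h2 h3
    exact (summable_mul_and_vecMul h2 (h3 0) h1).1
  · exact (hSr.comp (hτ.prodMk hA)).aemeasurable.congr hvec.symm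
  · rw [Measure.map_congr hvec]
    have e1 : P.map (fun ω j => (S (τ ω, toEMat (M 0 ω)) j).toReal) =
        (P.map fun ω => (τ ω, toEMat (M 0 ω))).map fun q j => (S q j).toReal := by
      rw [Measure.map_map hSr (hτ.prodMk hA)]
      rfl
    have e2 : (fun (q : EMat × (ℕ → EMat)) j => (S (Ξ q.2, q.1) j).toReal)
        =ᵐ[(exchangeLaw (rowLaw ρ)).prod (envLaw (rowLaw ρ))] fun q => Ξ (consMat q.1 q.2) := by
      filter_upwards [hpush] with q hq
      funext j
      simp only [S, hq]
      exact ENNReal.toReal_ofReal (h.nonneg _ j)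
    rw [e1, hjoint, Measure.map_map hSr hcanon]
    refine (Measure.map_congr e2).trans ?_
    conv_rhs => rw [coe_limitLaw, ← map_consMat, Measure.map_map h.measurable (by fun_prop)]
    rfl

variable {Ω : Type*} [MeasurableSpace Ω] {P : Measure Ω} [IsProbabilityMeasure P]
  {M : ℕ → Ω → Mat} {τ : Ω → Config} {m : ℝ}

/-- Time reversal expresses the law of the configuration after `n` exchanges through the
reversed products. -/
lemma IsInitial.summable_and_map_vecMul (hτ : IsInitial P τ m) (hM : IsExchange ρ P M)
    (hρ : IsSharingLaw ρ) (hind : IndepFun τ (fun ω n => M n ω) P) (n : ℕ) :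
    (∀ᵐ ω ∂P, ∀ j, Summable fun i => τ ω i * matProd (fun k => M k ω) n i j) ∧
      AEMeasurable (fun ω => vecMul (τ ω) (matProd (fun k => M k ω) n)) P ∧
      P.map (fun ω => vecMul (τ ω) (matProd (fun k => M k ω) n)) =
        (P.prod (envLaw (rowLaw ρ))).map fun q j => (initialMass τ n q j).toReal := by
  let T : Ω → ℤ → ℝ≥0∞ := fun ω i => ENNReal.ofReal (τ ω i)
  let R : Ω → ℕ → EMat := fun ω k => toEMat (M (revTime n k) ω)
  have hT : Measurable T := measurable_ofReal_pi.comp hτ.measurable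
  have hR : Measurable R :=
    measurable_pi_lambda _ fun k => measurable_toEMat.comp (hM.measurable_mat _)
  let S : (ℤ → ℝ≥0∞) × (ℕ → EMat) → ℤ → ℝ≥0∞ := fun q => push q.1 (backProd n q.2)
  have hS : Measurable S := by fun_prop
  have hSr : Measurable fun q j => (S q j).toReal :=
    measurable_pi_lambda _ fun j => ((measurable_pi_apply j).comp hS).ennreal_toReal
  have hT2 : Measurable fun q : Ω × (ℕ → EMat) => (T q.1, q.2) :=
    (hT.comp measurable_fst).prodMk measurable_snd
  have hjoint : P.map (fun ω => (T ω, R ω)) =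
      (P.prod (envLaw (rowLaw ρ))).map fun q => (T q.1, q.2) :=
    map_prodMk_env hM hτ.measurable hind n
  have hfin : ∀ᵐ ω ∂P, ∀ j, S (T ω, R ω) j ≠ ∞ := by
    rw [ae_all_iff]
    intro j
    have hSj : Measurable fun q => S q j := (measurable_pi_apply j).comp hS
    have h1 : ∫⁻ ω, S (T ω, R ω) j ∂P = ENNReal.ofReal m := by
      rw [← hτ.lintegral_initialMass (ae_rowLaw_tsum hρ) n j,
        ← lintegral_map (f := fun q => S q j) hSj (hT.prodMk hR), hjoint, lintegral_map hSj hT2]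
      rfl
    filter_upwards [ae_lt_top (hSj.comp (hT.prodMk hR)) (by
      simp only [Function.comp_apply, h1]; exact ENNReal.ofReal_ne_top)] with ω hω
    exact hω.ne
  have hnn : ∀ᵐ ω ∂P, ∀ i, 0 ≤ τ ω i := ae_all_iff.2 hτ.nonneg
  have hmain : ∀ᵐ ω ∂P, (∀ j, Summable fun i => τ ω i * matProd (fun k => M k ω) n i j) ∧
      vecMul (τ ω) (matProd (fun k => M k ω) n) = fun j => (S (T ω, R ω) j).toReal := by
    filter_upwards [hfin, hnn, hM.ae_isStochastic hρ] with ω h1 h2 h3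
    have h4 := toEMat_matProd_eq_revTime h3 n
    have h5 := summable_mul_and_vecMul h2 (IsStochastic.matProd h3 n)
    rw [h4] at h5
    exact h5 h1
  have hvec : (fun ω => vecMul (τ ω) (matProd (fun k => M k ω) n)) =ᵐ[P] fun ω j =>
      (S (T ω, R ω) j).toReal := hmain.mono fun ω h => h.2
  refine ⟨hmain.mono fun ω h => h.1,
    (hSr.comp (hT.prodMk hR)).aemeasurable.congr hvec.symm, ?_⟩
  rw [Measure.map_congr hvec]
  have e1 := Measure.map_map (μ := P) hSr (hT.prodMk hR)
  rw [hjoint, Measure.map_map hSr hT2] at e1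
  exact e1.symm

lemma IsInitial.weakConv (hτ : IsInitial P τ m) (hM : IsExchange ρ P M)
    (hρ : IsSharingLaw ρ) (hnd : ¬ IsAlmostSurelyDirac ρ)
    (hind : IndepFun τ (fun ω n => M n ω) P) (h : IsLimitMass (rowLaw ρ) Ξ) :
    WeakConv P (limitLaw ρ h.measurable : Measure Config)
      (fun n ω => vecMul (τ ω) (matProd (fun k => M k ω) n)) (fun x i => m * x i) := by
  intro J
  have hJ : Measurable fun (x : Config) (j : J) => x j := by fun_prop
  have hG (j : ℤ) : Measurable fun q : Ω × (ℕ → EMat) => m * Ξ q.2 j :=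
    (((measurable_pi_apply j).comp h.measurable).comp measurable_snd).const_mul m
  have hlim := tendstoInDistribution_of_lintegral_sqDist (Q := P.prod (envLaw (rowLaw ρ)))
    (Y := initialMass τ) hτ.measurable_initialMass (G := fun q j => m * Ξ q.2 j) hG
    (fun q j => mul_nonneg hτ.mean_nonneg (h.nonneg _ j))
    (hτ.tendsto_lintegral_sqDist (ae_rowLaw_tsum hρ) (not_ae_rowLaw_dirac hnd) h) J
  have hm : Measurable fun (x : Config) (j : J) => m * x j := by fun_prop
  refine tendstoInDistribution_of_map_eq hlim (fun n => ?_) hm.aemeasurable (fun n => ?_) ?_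
  · exact hJ.comp_aemeasurable (hτ.summable_and_map_vecMul hM hρ hind n).2.1
  · obtain ⟨-, h1, h2⟩ := hτ.summable_and_map_vecMul hM hρ hind n
    have h3 : Measurable fun (q : Ω × (ℕ → EMat)) j => (initialMass τ n q j).toReal :=
      measurable_pi_lambda _ fun j => (hτ.measurable_initialMass n j).ennreal_toReal
    have h4 := AEMeasurable.map_map_of_aemeasurable hJ.aemeasurable h1
    rw [h2, Measure.map_map hJ h3] at h4
    exact h4.symm
  · rw [coe_limitLaw, Measure.map_map hm h.measurable]
    have h1 : Measurable fun (r : ℕ → EMat) (j : J) => m * Ξ r j := hm.comp h.measurable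
    have h2 := Measure.map_map (μ := P.prod (envLaw (rowLaw ρ))) h1 measurable_snd
    rw [Measure.map_snd_prod, measure_univ, one_smul] at h2
    exact h2

/-- A non-negative configuration, some multiple of which has the law of a positive multiple of the
mean one configuration `ν`, is a positive multiple of `ν` in law. -/
lemma exists_pos_map_eq {ν ν' : Measure Config} {a m : ℝ} (hm : 0 < m)
    (hν : ∫ x : Config, x 0 ∂ν = 1) (hν' : ∀ᵐ x ∂ν', ∀ i, 0 ≤ x i)
    (h : ν'.map (fun x i => a * x i) = ν.map fun x i => m * x i) :
    ∃ c : ℝ, 0 < c ∧ ν' = ν.map fun x i => c * x i := by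
  have hmul (c : ℝ) : Measurable fun (x : Config) (i : ℤ) => c * x i := by fun_prop
  have h0 : Measurable fun x : Config => x 0 := measurable_pi_apply 0
  have ha : 0 < a := by
    by_contra! ha
    have h1 : ∫ x : Config, x 0 ∂(ν.map fun x i => m * x i) = m := by
      rw [integral_map (hmul m).aemeasurable h0.aestronglyMeasurable, integral_const_mul, hν,
        mul_one]
    rw [← h, integral_map (hmul a).aemeasurable h0.aestronglyMeasurable] at h1
    have h2 : ∫ x : Config, a * x 0 ∂ν' ≤ 0 := by
      refine integral_nonpos_of_ae ?_
      filter_upwards [hν'] with x hx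
      exact mul_nonpos_of_nonpos_of_nonneg ha (hx 0)
    linarith
  refine ⟨a⁻¹ * m, by positivity, ?_⟩
  have h1 := congrArg (Measure.map fun (x : Config) (i : ℤ) => a⁻¹ * x i) h
  rw [Measure.map_map (hmul _) (hmul _), Measure.map_map (hmul _) (hmul _)] at h1
  have e1 : ((fun (x : Config) (i : ℤ) => a⁻¹ * x i) ∘ fun (x : Config) i => a * x i) = id := by
    funext x i
    simp [ha.ne']
  have e2 : ((fun (x : Config) (i : ℤ) => a⁻¹ * x i) ∘ fun (x : Config) i => m * x i) =
      fun x i => a⁻¹ * m * x i := by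
    funext x i
    simp [mul_assoc]
  rw [e1, e2, Measure.map_id] at h1
  exact h1

end

end MassExchange

theorem theorem2 (ρ : ProbabilityMeasure (ℤ → ℝ))
    (hρ : MassExchange.IsSharingLaw ρ) (hnd : ¬ MassExchange.IsAlmostSurelyDirac ρ) :
    ∃ ν : ProbabilityMeasure MassExchange.Config,
      -- `ν`, the law of `τ^∞`, is a fixed point, normalised to have mean one
      MassExchange.IsFixedPoint.{u} ρ ν ∧
      (∀ j : ℤ, Integrable (fun x : MassExchange.Config => x j) (ν : Measure MassExchange.Config) ∧
        ∫ x : MassExchange.Config, x j ∂(ν : Measure MassExchange.Config) = 1) ∧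
      -- every i.i.d. square integrable initial configuration with mean `m` converges to `m τ^∞`
      (∀ (Ω : Type u) [MeasurableSpace Ω] (P : Measure Ω) [IsProbabilityMeasure P]
        (τ : Ω → MassExchange.Config) (m : ℝ) (M : ℕ → Ω → MassExchange.Mat),
        MassExchange.IsExchange ρ P M → MassExchange.IsInitial P τ m →
        IndepFun τ (fun ω n => M n ω) P →
          (∀ᵐ ω ∂P, ∀ n j, Summable fun i =>
            τ ω i * MassExchange.matProd (fun k => M k ω) n i j) ∧
          MassExchange.WeakConv P (ν : Measure MassExchange.Config)
            (fun n ω => MassExchange.vecMul (τ ω) (MassExchange.matProd (fun k => M k ω) n))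
            (fun x i => m * x i)) ∧
      -- uniqueness up to scaling: a fixed point `ν'` that, up to a scalar, is the limit from at
      -- least one such initial configuration with positive mean is a positive multiple of `τ^∞`
      (∀ ν' : ProbabilityMeasure MassExchange.Config, MassExchange.IsFixedPoint.{u} ρ ν' →
        (∃ (Ω : Type u) (_ : MeasurableSpace Ω) (P : Measure Ω) (_ : IsProbabilityMeasure P)
          (τ : Ω → MassExchange.Config) (m a : ℝ) (M : ℕ → Ω → MassExchange.Mat),
          MassExchange.IsExchange ρ P M ∧ MassExchange.IsInitial P τ m ∧ 0 < m ∧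
          IndepFun τ (fun ω n => M n ω) P ∧
          MassExchange.WeakConv P (ν' : Measure MassExchange.Config)
            (fun n ω => MassExchange.vecMul (τ ω) (MassExchange.matProd (fun k => M k ω) n))
            (fun x i => a * x i)) →
        ∃ c : ℝ, 0 < c ∧
          (ν' : Measure MassExchange.Config) =
            (ν : Measure MassExchange.Config).map (fun x i => c * x i)) := by
  have hη := MassExchange.ae_rowLaw_tsum hρ
  have hη' := MassExchange.not_ae_rowLaw_dirac hnd
  obtain ⟨Ξ, hΞ⟩ := MassExchange.exists_isLimitMass hη hη'
  refine ⟨MassExchange.limitLaw ρ hΞ.measurable, hΞ.isFixedPoint hρ,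
    hΞ.integrable_and_integral_eq hρ, ?_, ?_⟩
  · intro Ω _ P _ τ m M hM hτ hind
    exact ⟨ae_all_iff.2 fun n => (hτ.summable_and_map_vecMul hM hρ hind n).1,
      hτ.weakConv hM hρ hnd hind hΞ⟩
  · rintro ν' hν' ⟨Ω, _, P, _, τ, m, a, M, hM, hτ, hm, hind, hconv⟩
    exact MassExchange.exists_pos_map_eq hm (hΞ.integrable_and_integral_eq hρ 0).2 hν'.1
      (hconv.map_eq (by fun_prop) (by fun_prop) (hτ.weakConv hM hρ hnd hind hΞ))
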